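/- Let $M$ be a von Neumann algebra on a complex Hilbert space $H$ with a faithful normal semifinite trace $\tau$. Let $L(M)$ be the $*$-algebra (under strong sum and strong product, i.e. the closures of $x+y$ and $xy$) of all operators measurable with respect to $M$: the closed, densely defined operators $x$ on $H$ that are affiliated with $M$ and for which there are projections $p_n\in M$ with $p_n\uparrow \mathbf 1$, $p_nH\subset D(x)$ and $\mathbf 1-p_n$ finite in $M$. For real $p\ge 1$ put $L^p(M,\tau)=\{x\in L(M):\tau(|x|^p)<\infty\}$, and let $L^\omega(M,\tau)=\bigcap_{p\ge 1}L^p(M,\tau)$ be the Arens algebra. A derivation of a complex algebra $A$ is a linear map $d:A\to A$ with $d(xy)=d(x)y+x\,d(y)$ for all $x,y\in A$. If $M$ is abelian, then every derivation of $L^\omega(M,\tau)$ is identically zero. In particular, the algebra $L^\omega(0,1)=\bigcap_{p\ge 1}L^p(0,1)$ of (classes of) complex measurable functions on $(0,1)$, with pointwise almost everywhere operations, has only the zero derivation. -/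

import Mathlib

open MeasureTheory Filter Topology
open scoped ENNReal NNReal InnerProductSpace

noncomputable section

namespace ArensAlgebra

section Operators

variable {H : Type*} [NormedAddCommGroup H] [InnerProductSpace ℂ H] [CompleteSpace H]

/-! ### Traces on the positive cone of a von Neumann algebra -/

/-- `a` belongs to the positive cone `M₊` of `M` (the order is the Loewner order on `B(H)`). -/
def IsPos (M : VonNeumannAlgebra H) (a : H →L[ℂ] H) : Prop :=
  a ∈ M ∧ 0 ≤ a

/-- `τ : M₊ → [0, ∞]` is a faithful normal semifinite trace. Only the values of `τ` on the
positive cone `M₊` are constrained (and only these are ever used). -/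
structure IsFaithfulNormalSemifiniteTrace (M : VonNeumannAlgebra H)
    (τ : (H →L[ℂ] H) → ℝ≥0∞) : Prop where
  map_add : ∀ a b, IsPos M a → IsPos M b → τ (a + b) = τ a + τ b
  map_smul : ∀ (c : ℝ≥0) (a), IsPos M a → τ (((c : ℝ) : ℂ) • a) = c * τ a
  trace : ∀ a ∈ M, τ (star a * a) = τ (a * star a)
  faithful : ∀ a, IsPos M a → τ a = 0 → a = 0
  normal : ∀ S : Set (H →L[ℂ] H), S.Nonempty → (∀ s ∈ S, IsPos M s) → DirectedOn (· ≤ ·) S →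
    ∀ a, IsPos M a → IsLUB S a → τ a = ⨆ s ∈ S, τ s
  semifinite : ∀ a, IsPos M a → a ≠ 0 → ∃ b, IsPos M b ∧ b ≠ 0 ∧ b ≤ a ∧ τ b < ∞

/-! ### Measurable operators affiliated with a von Neumann algebra -/

/-- `x` is affiliated with `M`: it commutes with every unitary of the commutant `M'`. -/
def IsAffiliated (M : VonNeumannAlgebra H) (x : H →ₗ.[ℂ] H) : Prop :=
  ∀ u ∈ unitary (H →L[ℂ] H), u ∈ M.commutant →
    ∀ ξ : x.domain, ∃ h : u (ξ : H) ∈ x.domain, x ⟨u (ξ : H), h⟩ = u (x ξ)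

/-- `p` is a finite projection of `M`: it is not Murray-von Neumann equivalent (through a partial
isometry `v` of `M`) to a proper subprojection of itself. -/
def IsFiniteProjection (M : VonNeumannAlgebra H) (p : H →L[ℂ] H) : Prop :=
  p ∈ M ∧ IsStarProjection p ∧
    ∀ v ∈ M, star v * v = p → v * star v ≤ p → v * star v = p

/-- The operators measurable with respect to `M` (in the sense of Segal), that is, the elements
of `L(M)`: closed, densely defined operators affiliated with `M` whose domain contains the ranges
of a sequence of projections `p n ∈ M` with `p n ↑ 1` and all `1 - p n` finite. -/
structure IsMeasurableOperator (M : VonNeumannAlgebra H) (x : H →ₗ.[ℂ] H) : Prop where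
  isClosed : x.IsClosed
  dense : Dense (x.domain : Set H)
  affiliated : IsAffiliated M x
  domain : ∃ p : ℕ → (H →L[ℂ] H), (∀ n, p n ∈ M ∧ IsStarProjection (p n)) ∧ Monotone p ∧
    (∀ ξ : H, Tendsto (fun n => p n ξ) atTop (𝓝 ξ)) ∧
    (∀ (n : ℕ) (ξ : H), p n ξ ∈ x.domain) ∧ ∀ n, IsFiniteProjection M (1 - p n)

/-- The product `x y` of unbounded operators, with domain `{ξ ∈ D(y) | y ξ ∈ D(x)}`. -/
def opComp (x y : H →ₗ.[ℂ] H) : H →ₗ.[ℂ] H :=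
  x.comp (y.domRestrict ((x.domain.comap y.toFun).map y.domain.subtype)) (by
    rintro ⟨v, hv, hv'⟩
    obtain ⟨w, hw, rfl⟩ := hv
    exact hw)

theorem mem_opComp_domain {x y : H →ₗ.[ℂ] H} {ξ : H} :
    ξ ∈ (opComp x y).domain ↔ ∃ h : ξ ∈ y.domain, y ⟨ξ, h⟩ ∈ x.domain := by
  constructor
  · rintro ⟨⟨w, hw, rfl⟩, _⟩
    exact ⟨w.2, hw⟩
  · rintro ⟨h, h'⟩
    exact ⟨⟨⟨ξ, h⟩, h', rfl⟩, h⟩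

theorem opComp_apply {x y : H →ₗ.[ℂ] H} {ξ : H} (h : ξ ∈ (opComp x y).domain)
    (h₁ : ξ ∈ y.domain) (h₂ : y ⟨ξ, h₁⟩ ∈ x.domain) :
    opComp x y ⟨ξ, h⟩ = x ⟨y ⟨ξ, h₁⟩, h₂⟩ := rfl

/-- The strong sum: the closure of `x + y`. -/
def strongAdd (x y : H →ₗ.[ℂ] H) : H →ₗ.[ℂ] H := (x + y).closure

/-- The strong product: the closure of `x y`. -/
def strongMul (x y : H →ₗ.[ℂ] H) : H →ₗ.[ℂ] H := (opComp x y).closure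

/-- The strong multiple by a scalar: the closure of `c x` (so that `0 x` is everywhere defined). -/
def strongSMul (c : ℂ) (x : H →ₗ.[ℂ] H) : H →ₗ.[ℂ] H := (c • x).closure

/-! ### The quantities `τ(|x|^p)` -/

/-- `B = (1 + x⋆ x)⁻¹ = (1 + |x|²)⁻¹`. -/
def IsAbsResolvent (x : H →ₗ.[ℂ] H) (B : H →L[ℂ] H) : Prop :=
  ∀ ξ : H, ∃ h : B ξ ∈ (opComp x.adjoint x).domain, B ξ + opComp x.adjoint x ⟨B ξ, h⟩ = ξ

theorem IsAbsResolvent.inner {x : H →ₗ.[ℂ] H} (hd : Dense (x.domain : Set H)) {B : H →L[ℂ] H}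
    (hB : IsAbsResolvent x B) (ξ : H) : ∃ h : B ξ ∈ x.domain, ∀ η : x.domain,
      ⟪ξ, (η : H)⟫_ℂ = ⟪B ξ, (η : H)⟫_ℂ + ⟪x ⟨B ξ, h⟩, x η⟫_ℂ := by
  obtain ⟨h, e⟩ := hB ξ
  obtain ⟨h₁, h₂⟩ := mem_opComp_domain.1 h
  refine ⟨h₁, fun η => ?_⟩
  rw [opComp_apply h h₁ h₂] at e
  conv_lhs => rw [← e]
  rw [inner_add_left]
  congr 1
  exact LinearPMap.adjoint_isFormalAdjoint hd ⟨_, h₂⟩ η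

/-- For a closed densely defined `x` the operator `(1 + x⋆ x)⁻¹` exists ... -/
theorem exists_isAbsResolvent {x : H →ₗ.[ℂ] H} (hc : x.IsClosed)
    (hd : Dense (x.domain : Set H)) : ∃ B, IsAbsResolvent x B := by
  let K : Submodule ℂ (WithLp 2 (H × H)) :=
    x.graph.comap (WithLp.linearEquiv 2 ℂ (H × H)).toLinearMap
  have hK : IsClosed (K : Set (WithLp 2 (H × H))) :=
    IsClosed.preimage (WithLp.prod_continuous_ofLp 2 H H) hc
  have : CompleteSpace K := hK.completeSpace_coe
  let J : H →L[ℂ] WithLp 2 (H × H) :=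
    (WithLp.prodContinuousLinearEquiv 2 ℂ H H).symm.toContinuousLinearMap.comp
      (ContinuousLinearMap.inl ℂ H H)
  let F : WithLp 2 (H × H) →L[ℂ] H :=
    (ContinuousLinearMap.fst ℂ H H).comp
      (WithLp.prodContinuousLinearEquiv 2 ℂ H H).toContinuousLinearMap
  refine ⟨F.comp (K.starProjection.comp J), fun ξ => ?_⟩
  have h1 : K.starProjection (J ξ) ∈ K := Submodule.starProjection_apply_mem _ _
  have h2 : J ξ - K.starProjection (J ξ) ∈ Kᗮ := Submodule.sub_starProjection_mem_orthogonal _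
  set q := K.starProjection (J ξ) with hq
  have hB : (F.comp (K.starProjection.comp J)) ξ = q.fst := rfl
  rw [hB]
  obtain ⟨w, hw1, hw2⟩ := (LinearPMap.mem_graph_iff x).1 h1
  have hw1' : (w : H) = q.fst := hw1
  have hw2' : x w = q.snd := hw2
  have hdom : q.fst ∈ x.domain := hw1' ▸ w.2
  have hwe : w = ⟨q.fst, hdom⟩ := Subtype.ext hw1'
  have key : ∀ η : x.domain, ⟪ξ - q.fst, (η : H)⟫_ℂ = ⟪x ⟨q.fst, hdom⟩, x η⟫_ℂ := by
    intro η
    have hη : WithLp.toLp 2 ((η : H), x η) ∈ K := LinearPMap.mem_graph x η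
    have := Submodule.inner_left_of_mem_orthogonal hη h2
    rw [WithLp.prod_inner_apply] at this
    have e1 : (J ξ - q).fst = ξ - q.fst := rfl
    have e2 : (J ξ - q).snd = 0 - q.snd := rfl
    have this' : ⟪(J ξ - q).fst, (η : H)⟫_ℂ + ⟪(J ξ - q).snd, x η⟫_ℂ = 0 := this
    rw [e1, e2, zero_sub, inner_neg_left, ← hw2', hwe] at this'
    exact add_neg_eq_zero.1 this'
  have hadj : x ⟨q.fst, hdom⟩ ∈ x.adjoint.domain :=
    LinearPMap.mem_adjoint_domain_of_exists _ ⟨ξ - q.fst, key⟩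
  refine ⟨mem_opComp_domain.2 ⟨hdom, hadj⟩, ?_⟩
  rw [opComp_apply _ hdom hadj,
    LinearPMap.adjoint_apply_eq hd ⟨_, hadj⟩ (x₀ := ξ - q.fst) key]
  abel

/-- ... and is unique ... -/
theorem IsAbsResolvent.unique {x : H →ₗ.[ℂ] H} (hd : Dense (x.domain : Set H))
    {B B' : H →L[ℂ] H} (hB : IsAbsResolvent x B) (hB' : IsAbsResolvent x B') : B = B' := by
  ext ξ
  obtain ⟨h, e⟩ := hB.inner hd ξ
  obtain ⟨h', e'⟩ := hB'.inner hd ξ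
  let δ : x.domain := ⟨B ξ, h⟩ - ⟨B' ξ, h'⟩
  have hz : ⟪(δ : H), (δ : H)⟫_ℂ + ⟪x δ, x δ⟫_ℂ = 0 := by
    have e1 : (δ : H) = B ξ - B' ξ := rfl
    have e2 : x δ = x ⟨B ξ, h⟩ - x ⟨B' ξ, h'⟩ := LinearPMap.map_sub x _ _
    have := e δ
    have := e' δ
    nth_rw 1 [e1]
    nth_rw 1 [e2]
    rw [inner_sub_left, inner_sub_left]
    linear_combination e' δ - e δ
  have hre := congrArg Complex.re hz
  rw [inner_self_eq_norm_sq_to_K, inner_self_eq_norm_sq_to_K] at hre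
  have hn : ‖(δ : H)‖ ^ 2 + ‖x δ‖ ^ 2 = 0 := by exact_mod_cast hre
  have : ‖(δ : H)‖ = 0 := by nlinarith [sq_nonneg ‖(δ : H)‖, sq_nonneg ‖x δ‖]
  exact sub_eq_zero.1 (norm_eq_zero.1 this)

/-- ... and self-adjoint. -/
theorem IsAbsResolvent.isSelfAdjoint {x : H →ₗ.[ℂ] H} (hd : Dense (x.domain : Set H))
    {B : H →L[ℂ] H} (hB : IsAbsResolvent x B) : IsSelfAdjoint B := by
  rw [ContinuousLinearMap.isSelfAdjoint_iff_isSymmetric]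
  intro ξ ζ
  obtain ⟨h, e⟩ := hB.inner hd ξ
  obtain ⟨h', e'⟩ := hB.inner hd ζ
  have h1 := e ⟨B ζ, h'⟩
  have h2 := congrArg (starRingEnd ℂ) (e' ⟨B ξ, h⟩)
  simp only [map_add, inner_conj_symm] at h2
  change ⟪B ξ, ζ⟫_ℂ = ⟪ξ, B ζ⟫_ℂ
  rw [h1, h2]

open Classical in
/-- The bounded operator `(1 + |x|²)⁻¹` of a closed densely defined operator `x`. -/
def absResolvent (x : H →ₗ.[ℂ] H) : H →L[ℂ] H :=
  if h : ∃ B, IsAbsResolvent x B then h.choose else 0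

theorem absResolvent_spec {x : H →ₗ.[ℂ] H} (hc : x.IsClosed) (hd : Dense (x.domain : Set H)) :
    IsAbsResolvent x (absResolvent x) := by
  have h := exists_isAbsResolvent hc hd
  rw [absResolvent, dif_pos h]
  exact h.choose_spec

/-- The function of `t = (1 + s²)⁻¹` that is equal to `min(s, n)^p` for every `s ≥ 0`. -/
def truncPow (p : ℝ) (n : ℕ) (t : ℝ) : ℝ :=
  √(1 / max t (1 / (1 + (n : ℝ) ^ 2)) - 1) ^ p

theorem truncPow_eq (p : ℝ) (n : ℕ) {s : ℝ} (hs : 0 ≤ s) :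
    truncPow p n (1 / (1 + s ^ 2)) = min s n ^ p := by
  have hn : (0 : ℝ) ≤ n := n.cast_nonneg
  unfold truncPow
  congr 1
  rcases le_total s n with h | h
  · rw [min_eq_left h, max_eq_left (by gcongr)]
    simp [hs]
  · rw [min_eq_right h, max_eq_right (by gcongr)]
    simp

theorem continuous_truncPow {p : ℝ} (hp : 0 ≤ p) (n : ℕ) : Continuous (truncPow p n) := by
  unfold truncPow
  refine Continuous.rpow_const ?_ fun _ => Or.inr hp
  refine Real.continuous_sqrt.comp (Continuous.sub ?_ continuous_const)
  refine continuous_const.div (continuous_id.max continuous_const) fun t => ?_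
  have : (0 : ℝ) < 1 / (1 + (n : ℝ) ^ 2) := by positivity
  exact (lt_max_of_lt_right this).ne'

/-- The bounded positive operator `min(|x|, n)^p`, by the continuous functional calculus of
`(1 + |x|²)⁻¹`. -/
def truncAbsPow (x : H →ₗ.[ℂ] H) (p : ℝ) (n : ℕ) : H →L[ℂ] H :=
  cfc (truncPow p n) (absResolvent x)

/-- `τ(|x|^p) ∈ [0, ∞]`; the trace of the positive, possibly unbounded operator `|x|^p` is the
supremum (limit) of the traces of its bounded truncations `min(|x|, n)^p`. -/
def traceAbsPow (τ : (H →L[ℂ] H) → ℝ≥0∞) (x : H →ₗ.[ℂ] H) (p : ℝ) : ℝ≥0∞ :=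
  ⨆ n : ℕ, τ (truncAbsPow x p n)

/-! ### The noncommutative Arens algebra and its derivations -/

/-- `L^p(M, τ) = {x ∈ L(M) | τ(|x|^p) < ∞}`. -/
def noncommLp (M : VonNeumannAlgebra H) (τ : (H →L[ℂ] H) → ℝ≥0∞) (p : ℝ) :
    Set (H →ₗ.[ℂ] H) :=
  {x | IsMeasurableOperator M x ∧ traceAbsPow τ x p < ∞}

/-- The Arens algebra `L^ω(M, τ) = ⋂_{p ≥ 1} L^p(M, τ)`. -/
def arens (M : VonNeumannAlgebra H) (τ : (H →L[ℂ] H) → ℝ≥0∞) : Set (H →ₗ.[ℂ] H) :=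
  ⋂ (p : ℝ) (_ : 1 ≤ p), noncommLp M τ p

/-- `d` is a derivation of `L^ω(M, τ)`, i.e. a linear map with `d(xy) = d(x)y + xd(y)`, for the
algebra operations of `L^ω(M, τ)` (strong sum, strong product, strong scalar multiple). -/
structure IsArensDerivation (M : VonNeumannAlgebra H) (τ : (H →L[ℂ] H) → ℝ≥0∞)
    (d : arens M τ → arens M τ) : Prop where
  map_add : ∀ x y z : arens M τ, (z : H →ₗ.[ℂ] H) = strongAdd x y →
    (d z : H →ₗ.[ℂ] H) = strongAdd (d x) (d y)
  map_smul : ∀ (c : ℂ) (x z : arens M τ), (z : H →ₗ.[ℂ] H) = strongSMul c x →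
    (d z : H →ₗ.[ℂ] H) = strongSMul c (d x)
  leibniz : ∀ x y z : arens M τ, (z : H →ₗ.[ℂ] H) = strongMul x y →
    (d z : H →ₗ.[ℂ] H) = strongAdd (strongMul (d x) y) (strongMul x (d y))

end Operators

/-! ### The Arens algebra of functions on a measure space -/

section Functions

variable {α : Type*} [MeasurableSpace α]

/-- `⋂_{p ≥ 1} L^p(μ)`, a linear space of classes of complex measurable functions modulo
equality almost everywhere. -/
def arensFun (μ : Measure α) : Submodule ℂ (α →ₘ[μ] ℂ) where
  carrier := {f | ∀ p : ℝ, 1 ≤ p → MemLp f (ENNReal.ofReal p) μ}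
  zero_mem' := fun _ _ => (memLp_congr_ae AEEqFun.coeFn_zero).2 MemLp.zero
  add_mem' := fun {f g} hf hg p hp =>
    (memLp_congr_ae (AEEqFun.coeFn_add f g)).2 ((hf p hp).add (hg p hp))
  smul_mem' := fun c f hf p hp =>
    (memLp_congr_ae (AEEqFun.coeFn_smul c f)).2 ((hf p hp).const_smul c)

theorem arensFun_mul_mem {μ : Measure α} {f g : α →ₘ[μ] ℂ} (hf : f ∈ arensFun μ)
    (hg : g ∈ arensFun μ) : f * g ∈ arensFun μ := by
  intro p hp
  have hpos : 0 < p := by linarith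
  have : ENNReal.HolderTriple (ENNReal.ofReal (2 * p)) (ENNReal.ofReal (2 * p))
      (ENNReal.ofReal p) := by
    constructor
    rw [← ENNReal.ofReal_inv_of_pos (by positivity), ← ENNReal.ofReal_inv_of_pos hpos,
      ← ENNReal.ofReal_add (by positivity) (by positivity)]
    congr 1
    field_simp
    norm_num
  exact (memLp_congr_ae (AEEqFun.coeFn_mul f g)).2
    ((hg (2 * p) (by linarith)).mul (hf (2 * p) (by linarith)))

/-- The (almost everywhere) pointwise product on `⋂_{p ≥ 1} L^p(μ)`. -/
instance instMulArensFun (μ : Measure α) : Mul (arensFun μ) :=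
  ⟨fun f g => ⟨f.1 * g.1, arensFun_mul_mem f.2 g.2⟩⟩

end Functions

/-- `L^ω(0, 1) = ⋂_{p ≥ 1} L^p(0, 1)`. -/
abbrev arensUnitInterval : Submodule ℂ (ℝ →ₘ[volume.restrict (Set.Ioo (0 : ℝ) 1)] ℂ) :=
  arensFun (volume.restrict (Set.Ioo (0 : ℝ) 1))

end ArensAlgebra

end

/-! A derivation of a commutative algebra kills idempotents: `e = e²` gives `d e = 2 e (d e)`, and
multiplying by `e` yields `e (d e) = 0`, so `d e = 0`. Hence `d` vanishes on the span of the
projections and satisfies `d (x e) = (d x) e`. Purely algebraic arguments stop here. The rest uses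
that the values of `d` are integrable, in a closed-graph style of contradiction.

Let `a ≥ 0` be bounded and supported on a projection `E` of finite trace. Subtracting combinations
of projections from `a` leaves remainders of arbitrarily small norm with the same derivative
(`IsAbelian.exists_approx`, `DerivRestrictsTo.congr_of_sub_mem_span`). If `d a ≠ 0`, then `|d a|² ≥
ε` on some projection `F ≠ 0`. No nonzero subprojection of `F` is minimal, since `a` is a scalar on
an atom, so `F` contains an infinite orthogonal sequence `e k`. Choose remainders `b k` so small
that `g = ∑ c k • b k * e k` converges in norm although the `c k` are huge. Then `g` is bounded on
`E`, while `d g = c k • d a` on `e k` forces `τ(|d g|) ≥ k` for every `k`, which is absurd.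

Unbounded operators enter only through their bounded pieces `x r = a` (`RestrictsTo`). A closed
operator is recovered from its pieces on projections converging strongly to `1`, and in the abelian
case two such sequences can be multiplied. The resolvent `(1 + |x|²)⁻¹` converts bounds on pieces
into bounds on `τ(|x|)`. Semifiniteness reduces a general `x` to the bounded, finite-trace case.

For functions the same argument runs with simple functions, disjoint sets and integrals; the absence
of atoms provides the disjoint sets directly. -/

set_option linter.unusedSectionVars false

noncomputable section

namespace ArensAlgebra

section VonNeumann

variable {H : Type*} [NormedAddCommGroup H] [InnerProductSpace ℂ H] [CompleteSpace H]
  {M : VonNeumannAlgebra H} {τ : (H →L[ℂ] H) → ℝ≥0∞}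

/-! ### Commutative von Neumann algebras -/

/-- `M` is abelian. -/
def IsAbelian (M : VonNeumannAlgebra H) : Prop := ∀ a ∈ M, ∀ b ∈ M, a * b = b * a

/-- `e` is a projection of `M`. -/
def IsProj (M : VonNeumannAlgebra H) (e : H →L[ℂ] H) : Prop := e ∈ M ∧ IsStarProjection e

theorem csmul_mem (c : ℂ) {a : H →L[ℂ] H} (ha : a ∈ M) : c • a ∈ M :=
  M.toStarSubalgebra.smul_mem (x := a) ha c

theorem rsmul_mem (c : ℝ) {a : H →L[ℂ] H} (ha : a ∈ M) : c • a ∈ M := by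
  rw [← Complex.coe_smul]
  exact csmul_mem _ ha

theorem isClosed_coe (M : VonNeumannAlgebra H) : IsClosed (M : Set (H →L[ℂ] H)) := by
  rw [← M.centralizer_centralizer]
  exact Set.isClosed_centralizer _

theorem mem_of_commute {a : H →L[ℂ] H} (h : ∀ t ∈ M.commutant, Commute t a) : a ∈ M := by
  rw [← M.commutant_commutant, VonNeumannAlgebra.mem_commutant_iff]
  exact h

theorem commute_of_mem_commutant {a t : H →L[ℂ] H} (ha : a ∈ M) (ht : t ∈ M.commutant) :
    Commute t a :=
  ((VonNeumannAlgebra.mem_commutant_iff.1 ht) a ha).symm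

/-- Affiliation only mentions unitaries of the commutant. They suffice because a C⋆-algebra is
spanned by its unitaries. -/
theorem mem_of_commute_unitary {a : H →L[ℂ] H}
    (h : ∀ u ∈ unitary (H →L[ℂ] H), u ∈ M.commutant → Commute u a) : a ∈ M := by
  refine mem_of_commute fun t ht => ?_
  let S := M.commutant.toStarSubalgebra
  have hS : IsClosed (S : Set (H →L[ℂ] H)) := isClosed_coe M.commutant
  have : IsClosed (S : Set (H →L[ℂ] H)) := hS
  let _ : CStarAlgebra S := StarSubalgebra.cstarAlgebra S
  have h1 : (⟨t, ht⟩ : S) ∈ Submodule.span ℂ (unitary S : Set S) := by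
    rw [CStarAlgebra.span_unitary]; trivial
  have key : ∀ s ∈ Submodule.span ℂ (unitary S : Set S), Commute (s : H →L[ℂ] H) a := by
    intro s hs
    induction hs using Submodule.span_induction with
    | mem x hx =>
      refine h x ?_ x.2
      have := Unitary.mem_iff.1 hx
      exact Unitary.mem_iff.2 ⟨congrArg Subtype.val this.1, congrArg Subtype.val this.2⟩
    | zero => exact Commute.zero_left _
    | add x y _ _ hx hy => exact hx.add_left hy
    | smul c x _ hx => exact hx.smul_left c
  exact key _ h1

namespace IsProj

theorem nonneg {e : H →L[ℂ] H} (he : IsProj M e) : 0 ≤ e := he.2.nonneg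

theorem mul_self {e : H →L[ℂ] H} (he : IsProj M e) : e * e = e := he.2.isIdempotentElem

theorem star_eq {e : H →L[ℂ] H} (he : IsProj M e) : star e = e := he.2.isSelfAdjoint

theorem one_sub {e : H →L[ℂ] H} (he : IsProj M e) : IsProj M (1 - e) :=
  ⟨sub_mem (one_mem M) he.1, he.2.one_sub⟩

theorem one : IsProj M 1 := ⟨one_mem M, .one (H →L[ℂ] H)⟩

theorem zero : IsProj M 0 := ⟨zero_mem M, .zero (H →L[ℂ] H)⟩

theorem isPos {e : H →L[ℂ] H} (he : IsProj M e) : IsPos M e := ⟨he.1, he.nonneg⟩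

theorem mul (hM : IsAbelian M) {e f : H →L[ℂ] H} (he : IsProj M e) (hf : IsProj M f) :
    IsProj M (e * f) := by
  refine ⟨mul_mem he.1 hf.1, ?_, ?_⟩
  · have := hM e he.1 f hf.1
    change e * f * (e * f) = e * f
    rw [mul_assoc, ← mul_assoc f, ← this, mul_assoc e, hf.mul_self, ← mul_assoc, he.mul_self]
  · rw [isSelfAdjoint_iff, star_mul, he.star_eq, hf.star_eq, hM e he.1 f hf.1]

theorem sub (hM : IsAbelian M) {e f : H →L[ℂ] H} (he : IsProj M e) (hf : IsProj M f)
    (h : f * e = f) : IsProj M (e - f) := by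
  have : e - f = e * (1 - f) := by rw [mul_sub, mul_one, hM e he.1 f hf.1, h]
  rw [this]
  exact he.mul hM hf.one_sub

end IsProj

theorem IsAbelian.mul_nonneg (hM : IsAbelian M) {a b : H →L[ℂ] H} (ha : a ∈ M) (hb : b ∈ M)
    (ha0 : 0 ≤ a) (hb0 : 0 ≤ b) : 0 ≤ a * b :=
  Commute.mul_nonneg ha0 hb0 (hM a ha b hb)

theorem IsAbelian.mul_le_mul_right (hM : IsAbelian M) {a b e : H →L[ℂ] H} (ha : a ∈ M)
    (hb : b ∈ M) (hab : a ≤ b) (he : IsPos M e) : a * e ≤ b * e := by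
  rw [← sub_nonneg, ← sub_mul]
  exact hM.mul_nonneg (sub_mem hb ha) he.1 (sub_nonneg.2 hab) he.2

/-- Multiplying the inequality by `1 - q` kills `h`, so the positive operator `e * (1 - q)` is also
`≤ 0`. -/
theorem eq_of_smul_le {e h q : H →L[ℂ] H} (hM : IsAbelian M) (he : IsProj M e)
    (hq : IsProj M q) (hh : h ∈ M) (hhq : h * q = h) {ε : ℝ} (hε : 0 < ε) (hle : ε • e ≤ h) :
    e * q = e := by
  have h1 := hM.mul_le_mul_right (rsmul_mem ε he.1) hh hle hq.one_sub.isPos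
  have h2 : h * (1 - q) = 0 := by rw [mul_sub, mul_one, hhq, sub_self]
  rw [h2, smul_mul_assoc] at h1
  have h3 : e * (1 - q) = 0 := by
    refine le_antisymm ?_ (he.mul hM hq.one_sub).nonneg
    have := smul_le_smul_of_nonneg_left h1 (inv_nonneg.2 hε.le)
    rwa [smul_smul, inv_mul_cancel₀ hε.ne', one_smul, smul_zero] at this
  rw [mul_sub, mul_one, sub_eq_zero] at h3
  exact h3.symm

/-! ### Spectral projections and approximation by projections -/

theorem exists_isProj_ker {a : H →L[ℂ] H} (ha : a ∈ M) :
    ∃ e, IsProj M e ∧ a * e = 0 ∧ ∀ b, a * b = 0 → e * b = b := by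
  let K : Submodule ℂ H := LinearMap.ker a.toLinearMap
  have hK : IsClosed (K : Set H) := a.isClosed_ker
  have : CompleteSpace K := hK.completeSpace_coe
  have hP : IsStarProjection K.starProjection := isStarProjection_starProjection
  refine ⟨K.starProjection, ⟨(VonNeumannAlgebra.IsStarProjection.mem_iff hP M).2 ?_, hP⟩, ?_, ?_⟩
  -- The kernel of `a` is invariant under everything that commutes with `a`, in particular under the
  -- commutant of `M`.
  · intro t ht
    rw [Module.End.mem_invtSubmodule]
    intro ξ hξ
    have hr : (K.starProjection).range = K := Submodule.range_starProjection K
    rw [hr] at hξ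
    rw [hr]
    have h1 : a ξ = 0 := hξ
    have h2 := DFunLike.congr_fun (commute_of_mem_commutant ha ht).eq ξ
    change t (a ξ) = a (t ξ) at h2
    change a (t ξ) = 0
    rw [← h2, h1, _root_.map_zero]
  · ext ξ
    exact (Submodule.starProjection_apply_mem K ξ : _ ∈ K)
  · intro b hb
    ext ξ
    refine Submodule.starProjection_eq_self_iff.2 ?_
    exact DFunLike.congr_fun hb ξ

theorem posPart_mem {a : H →L[ℂ] H} (ha : a ∈ M) : a⁺ ∈ M := by
  by_cases hs : IsSelfAdjoint a
  · refine mem_of_commute fun t ht => ?_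
    rw [CFC.posPart_def]
    exact (hs.commute_cfcₙ (commute_of_mem_commutant ha ht).symm _).symm
  · rw [CFC.posPart_eq_zero_of_not_isSelfAdjoint hs]
    exact zero_mem M

/-- The spectral projection of `a` for the half line `(0, ∞)`. -/
theorem IsAbelian.exists_isProj_cut (hM : IsAbelian M) {a : H →L[ℂ] H} (ha : a ∈ M)
    (hs : IsSelfAdjoint a) : ∃ e, IsProj M e ∧ 0 ≤ a * e ∧ a * (1 - e) ≤ 0 := by
  have hp := posPart_mem ha
  have hn : a⁻ ∈ M := by rw [← CFC.posPart_neg]; exact posPart_mem (neg_mem ha)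
  have hd := CFC.posPart_sub_negPart a
  -- With `q` the projection onto the kernel of `a⁺`, the relation `a⁺ * a⁻ = 0` puts the range of
  -- `a⁻` under `q`; so `1 - q` cuts out exactly `a⁺`.
  obtain ⟨q, hq, h1, h2⟩ := exists_isProj_ker hp
  have h3 := h2 _ (CFC.posPart_mul_negPart a)
  rw [hM _ hq.1 _ hn] at h3
  refine ⟨1 - q, hq.one_sub, ?_, ?_⟩
  · have : a * (1 - q) = a⁺ := by
      rw [mul_sub, mul_one]
      conv_lhs => rw [← hd]
      rw [sub_mul, h1, h3]
      abel
    rw [this]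
    exact CFC.posPart_nonneg a
  · have : a * (1 - (1 - q)) = -a⁻ := by
      rw [sub_sub_cancel]
      conv_lhs => rw [← hd]
      rw [sub_mul, h1, h3, zero_sub]
    rw [this]
    exact neg_nonpos.2 (CFC.negPart_nonneg a)

theorem le_norm_smul_one {a : H →L[ℂ] H} (ha : IsSelfAdjoint a) : a ≤ ‖a‖ • 1 := by
  have := ha.le_algebraMap_norm_self
  rwa [Algebra.algebraMap_eq_smul_one] at this

theorem neg_norm_smul_one_le {a : H →L[ℂ] H} (ha : IsSelfAdjoint a) : -(‖a‖ • 1) ≤ a := by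
  have := ha.neg_algebraMap_norm_le_self
  rwa [Algebra.algebraMap_eq_smul_one] at this

theorem norm_le_of_le_smul {a e : H →L[ℂ] H} (he : IsProj M e) (ha : 0 ≤ a) {c : ℝ} (hc : 0 ≤ c)
    (h : a ≤ c • e) : ‖a‖ ≤ c := by
  refine (CStarAlgebra.norm_le_norm_of_nonneg_of_le ha h).trans ?_
  rw [norm_smul, Real.norm_of_nonneg hc]
  exact mul_le_of_le_one_right hc he.2.norm_le

theorem sub_smul_one_mem {a : H →L[ℂ] H} (ha : a ∈ M) (c : ℝ) :
    a - c • (1 : H →L[ℂ] H) ∈ M := by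
  have h1 : (1 : H →L[ℂ] H) ∈ M := one_mem M
  have h2 : c • (1 : H →L[ℂ] H) ∈ M := rsmul_mem c h1
  exact sub_mem ha h2

theorem isSelfAdjoint_sub_smul_one {a : H →L[ℂ] H} (ha : 0 ≤ a) (c : ℝ) :
    IsSelfAdjoint (a - c • (1 : H →L[ℂ] H)) := by
  have h1 : IsSelfAdjoint (1 : H →L[ℂ] H) := IsSelfAdjoint.one _
  have h2 : IsSelfAdjoint (c • (1 : H →L[ℂ] H)) := IsSelfAdjoint.smul (.all c) h1
  exact (IsSelfAdjoint.of_nonneg ha).sub h2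

/-- A nonzero positive element dominates a positive multiple of a nonzero projection. -/
theorem IsAbelian.exists_isProj_smul_le (hM : IsAbelian M) {h : H →L[ℂ] H} (hh : IsPos M h)
    (h0 : h ≠ 0) : ∃ e, IsProj M e ∧ e ≠ 0 ∧ ∃ ε : ℝ, 0 < ε ∧ ε • e ≤ h := by
  have hn : 0 < ‖h‖ := norm_pos_iff.2 h0
  -- Any level strictly between `0` and `‖h‖` works: if the cut at `ε` were zero, then `h ≤ ε` and
  -- `‖h‖ ≤ ε`.
  set ε := ‖h‖ / 2 with hε
  have hε0 : 0 < ε := by positivity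
  obtain ⟨e, he, h1, h2⟩ := hM.exists_isProj_cut (sub_smul_one_mem hh.1 ε)
    (isSelfAdjoint_sub_smul_one hh.2 ε)
  refine ⟨e, he, ?_, ε, hε0, ?_⟩
  · rintro rfl
    rw [sub_zero, mul_one, sub_nonpos] at h2
    have := norm_le_of_le_smul (IsProj.one (M := M)) hh.2 hε0.le h2
    linarith
  · rw [sub_mul, smul_mul_assoc, one_mul, sub_nonneg] at h1
    refine h1.trans ?_
    have : h * e + h * (1 - e) = h := by rw [← mul_add]; simp
    conv_rhs => rw [← this]
    exact le_add_of_nonneg_right (hM.mul_nonneg hh.1 he.one_sub.1 hh.2 he.one_sub.nonneg)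

/-- Binary approximation of a positive element by linear combinations of projections. -/
theorem IsAbelian.exists_approx (hM : IsAbelian M) {a E : H →L[ℂ] H} (ha : a ∈ M) (ha0 : 0 ≤ a)
    (hE : IsProj M E) (haE : a * E = a) {c : ℝ} (hc : a ≤ c • E) (n : ℕ) :
    ∃ b ∈ M, 0 ≤ b ∧ b ≤ (c / 2 ^ n) • E ∧ b * E = b ∧
      a - b ∈ Submodule.span ℂ {e | IsProj M e ∧ e * E = e} := by
  induction n with
  | zero => exact ⟨a, ha, ha0, by simpa using hc, haE, by simp⟩
  | succ n ih =>
    obtain ⟨b, hb, hb0, hbc, hbE, hspan⟩ := ih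
    -- One binary digit: cut `b` at half its bound and subtract `κ` on the part where `b ≥ κ`. On
    -- both parts the remainder then lies between `0` and `κ`.
    set κ : ℝ := c / 2 ^ (n + 1) with hκ
    have hκ2 : c / 2 ^ n = κ + κ := by rw [hκ, pow_succ]; field_simp; norm_num
    have hm := sub_smul_one_mem hb κ
    obtain ⟨e, he, h1, h2⟩ := hM.exists_isProj_cut hm (isSelfAdjoint_sub_smul_one hb0 κ)
    have heE : IsProj M (e * E) := he.mul hM hE
    have hEe := hM E hE.1 e he.1
    have hbm : b - κ • (e * E) ∈ M := sub_mem hb (rsmul_mem κ heE.1)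
    have e1 : (b - κ • (1 : H →L[ℂ] H)) * e * E = b * e - κ • (e * E) := by
      rw [sub_mul, sub_mul, smul_mul_assoc, one_mul, smul_mul_assoc, mul_assoc, ← hEe,
        ← mul_assoc, hbE]
    have e2 : (b - κ • (1 : H →L[ℂ] H)) * (1 - e) * E = b * (1 - e) - κ • (E - e * E) := by
      rw [sub_mul, sub_mul, smul_mul_assoc, one_mul, smul_mul_assoc, mul_assoc, sub_mul, one_mul,
        ← hEe, mul_sub, ← mul_assoc, hbE, mul_sub, mul_one]
    have e3 : (c / 2 ^ n) • E * e = κ • (e * E) + κ • (e * E) := by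
      rw [hκ2, add_smul, add_mul, smul_mul_assoc, hEe]
    refine ⟨b - κ • (e * E), hbm, ?_, ?_, ?_, ?_⟩
    · have h3 := hM.mul_nonneg (mul_mem hm he.1) hE.1 h1
        hE.nonneg
      have h4 := hM.mul_nonneg hb he.one_sub.1 hb0 he.one_sub.nonneg
      rw [e1] at h3
      have : b - κ • (e * E) = (b * e - κ • (e * E)) + b * (1 - e) := by
        rw [mul_sub, mul_one]; abel
      rw [this]
      exact add_nonneg h3 h4
    · have h3 := hM.mul_le_mul_right (mul_mem hm
        he.one_sub.1) (zero_mem M) h2 hE.isPos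
      rw [zero_mul, e2, sub_nonpos] at h3
      have h4 := hM.mul_le_mul_right hb (rsmul_mem _ hE.1) hbc he.isPos
      rw [e3] at h4
      have : b - κ • (e * E) = b * e + b * (1 - e) - κ • (e * E) := by
        rw [mul_sub, mul_one]; abel
      rw [this]
      refine (sub_le_sub_right (add_le_add h4 h3) _).trans (le_of_eq ?_)
      rw [smul_sub]
      abel
    · rw [sub_mul, hbE, smul_mul_assoc, mul_assoc, hE.mul_self]
    · have : a - (b - κ • (e * E)) = (a - b) + ((κ : ℝ) : ℂ) • (e * E) := by
        rw [Complex.coe_smul]; abel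
      rw [this]
      refine add_mem hspan (Submodule.smul_mem _ _ (Submodule.subset_span ⟨heE, ?_⟩))
      rw [mul_assoc, hE.mul_self]

/-! ### The trace -/

namespace IsFaithfulNormalSemifiniteTrace

theorem mono (hτ : IsFaithfulNormalSemifiniteTrace M τ) {a b : H →L[ℂ] H} (ha : IsPos M a)
    (hb : IsPos M b) (hab : a ≤ b) : τ a ≤ τ b := by
  have h : τ (a + (b - a)) = τ a + τ (b - a) :=
    hτ.map_add a (b - a) ha ⟨sub_mem hb.1 ha.1, sub_nonneg.2 hab⟩
  rw [add_sub_cancel] at h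
  rw [h]
  exact le_self_add

theorem map_rsmul (hτ : IsFaithfulNormalSemifiniteTrace M τ) {a : H →L[ℂ] H} (ha : IsPos M a)
    {c : ℝ} (hc : 0 ≤ c) : τ (c • a) = ENNReal.ofReal c * τ a := by
  have := hτ.map_smul c.toNNReal a ha
  rwa [Real.coe_toNNReal c hc, Complex.coe_smul] at this

/-- Semifiniteness yields a positive element of finite trace below `q`, and that element dominates a
multiple of a nonzero projection. -/
theorem exists_finite_isProj (hτ : IsFaithfulNormalSemifiniteTrace M τ) (hM : IsAbelian M)
    {q : H →L[ℂ] H} (hq : IsProj M q) (h0 : q ≠ 0) :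
    ∃ e, IsProj M e ∧ e ≠ 0 ∧ e * q = e ∧ τ e < ∞ := by
  obtain ⟨b, hb, hb0, hbq, hfin⟩ := hτ.semifinite q hq.isPos h0
  obtain ⟨e, he, he0, ε, hε, hle⟩ := hM.exists_isProj_smul_le hb hb0
  have hbq' : b * q = b := (hq.2.mul_right_and_mul_left_of_nonneg_of_le hb.2 hbq).1
  refine ⟨e, he, he0, eq_of_smul_le hM he hq hb.1 hbq' hε hle, ?_⟩
  have h1 := (hτ.mono ⟨rsmul_mem ε he.1, smul_nonneg hε.le he.nonneg⟩ hb hle).trans_lt hfin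
  rw [hτ.map_rsmul he.isPos hε.le] at h1
  exact ENNReal.lt_top_of_mul_ne_top_right h1.ne (ENNReal.ofReal_pos.2 hε).ne'

end IsFaithfulNormalSemifiniteTrace

/-! ### Unbounded operators on the range of a projection -/

/-- `x r` is everywhere defined and equal to `a`. -/
def RestrictsTo (x : H →ₗ.[ℂ] H) (r a : H →L[ℂ] H) : Prop := ∀ ξ : H, (r ξ, a ξ) ∈ x.graph

/-- A bounded operator as a partially defined operator with full domain. -/
def ofBounded (a : H →L[ℂ] H) : H →ₗ.[ℂ] H := (a : H →ₗ[ℂ] H).toPMap ⊤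

theorem mem_graph_ofBounded {a : H →L[ℂ] H} {ξ η : H} :
    (ξ, η) ∈ (ofBounded a).graph ↔ a ξ = η := by
  rw [LinearPMap.mem_graph_iff]
  constructor
  · rintro ⟨y, rfl, rfl⟩
    rfl
  · rintro rfl
    exact ⟨⟨ξ, trivial⟩, rfl, rfl⟩

theorem eq_ofBounded {x : H →ₗ.[ℂ] H} {a : H →L[ℂ] H} (h : RestrictsTo x 1 a) :
    x = ofBounded a := by
  refine (LinearPMap.eq_of_le_of_domain_eq (LinearPMap.le_of_le_graph ?_) ?_).symm
  · rintro ⟨ξ, η⟩ hξ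
    rw [mem_graph_ofBounded] at hξ
    exact hξ ▸ h ξ
  · refine le_antisymm (fun ξ _ => LinearPMap.mem_domain_of_mem_graph (h ξ)) le_top

theorem isClosed_ofBounded (a : H →L[ℂ] H) : (ofBounded a).IsClosed := by
  have : ((ofBounded a).graph : Set (H × H)) = {p | a p.1 = p.2} := by
    ext ⟨ξ, η⟩
    exact mem_graph_ofBounded
  rw [LinearPMap.IsClosed, this]
  exact isClosed_eq (by fun_prop) (by fun_prop)

theorem dense_ofBounded (a : H →L[ℂ] H) : Dense ((ofBounded a).domain : Set H) := by
  have : ((ofBounded a).domain : Set H) = Set.univ := rfl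
  rw [this]
  exact dense_univ

theorem ofBounded_zero : ofBounded (0 : H →L[ℂ] H) = 0 := rfl

namespace RestrictsTo

variable {x y : H →ₗ.[ℂ] H} {r s a b c : H →L[ℂ] H}

theorem unique (h : RestrictsTo x r a) (h' : RestrictsTo x r b) : a = b := by
  ext ξ
  exact LinearPMap.mem_graph_snd_inj x (h ξ) (h' ξ) rfl

theorem mul_right (h : RestrictsTo x r a) (s : H →L[ℂ] H) : RestrictsTo x (r * s) (a * s) :=
  fun ξ => h (s ξ)

theorem mono (hxy : x ≤ y) (h : RestrictsTo x r a) : RestrictsTo y r a :=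
  fun ξ => LinearPMap.le_graph_of_le hxy (h ξ)

theorem closure (h : RestrictsTo x r a) : RestrictsTo x.closure r a := h.mono x.le_closure

theorem add (hx : RestrictsTo x r a) (hy : RestrictsTo y r b) :
    RestrictsTo (x + y) r (a + b) := fun ξ => by
  obtain ⟨u, hu, hu'⟩ := (LinearPMap.mem_graph_iff x).1 (hx ξ)
  obtain ⟨v, hv, hv'⟩ := (LinearPMap.mem_graph_iff y).1 (hy ξ)
  refine (LinearPMap.mem_graph_iff _).2 ⟨⟨r ξ, LinearPMap.mem_domain_of_mem_graph (hx ξ),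
    LinearPMap.mem_domain_of_mem_graph (hy ξ)⟩, rfl, ?_⟩
  rw [LinearPMap.add_apply]
  change _ = a ξ + b ξ
  dsimp only at hu hv hu' hv'
  exact congrArg₂ (· + ·) ((congrArg x (Subtype.ext hu.symm)).trans hu')
    ((congrArg y (Subtype.ext hv.symm)).trans hv')

theorem smul (hx : RestrictsTo x r a) (k : ℂ) : RestrictsTo (k • x) r (k • a) := fun ξ => by
  obtain ⟨u, hu, hu'⟩ := (LinearPMap.mem_graph_iff x).1 (hx ξ)
  refine (LinearPMap.mem_graph_iff _).2 ⟨u, hu, ?_⟩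
  rw [LinearPMap.smul_apply, hu']
  rfl

theorem opComp (hy : RestrictsTo y r b) (hx : RestrictsTo x b c) :
    RestrictsTo (opComp x y) r c := fun ξ => by
  obtain ⟨u, hu, hu'⟩ := (LinearPMap.mem_graph_iff y).1 (hy ξ)
  obtain ⟨v, hv, hv'⟩ := (LinearPMap.mem_graph_iff x).1 (hx ξ)
  dsimp only at hu hv hu' hv'
  have h1 : y ⟨u, u.2⟩ ∈ x.domain := by rw [Subtype.coe_eta, hu', ← hv]; exact v.2
  have h2 : (u : H) ∈ (ArensAlgebra.opComp x y).domain := mem_opComp_domain.2 ⟨u.2, h1⟩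
  refine (LinearPMap.mem_graph_iff _).2 ⟨⟨u, h2⟩, hu, ?_⟩
  rw [opComp_apply h2 u.2 h1]
  dsimp only
  rw [← hv']
  congr 1
  exact Subtype.ext (by rw [hv, ← hu'])

theorem ofBounded (a r : H →L[ℂ] H) : RestrictsTo (ofBounded a) r (a * r) := fun _ =>
  mem_graph_ofBounded.2 rfl

theorem strongAdd (hx : RestrictsTo x r a) (hy : RestrictsTo y r b) :
    RestrictsTo (strongAdd x y) r (a + b) := (hx.add hy).closure

theorem strongSMul (hx : RestrictsTo x r a) (k : ℂ) :
    RestrictsTo (strongSMul k x) r (k • a) := (hx.smul k).closure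

theorem strongMul (hy : RestrictsTo y r b) (hx : RestrictsTo x b c) :
    RestrictsTo (strongMul x y) r c := (hy.opComp hx).closure

/-- Closedness of the graph passes the relation to the limit. Identities for measurable operators
therefore need checking only on bounded pieces. -/
theorem of_tendsto (hx : x.IsClosed) {e v : H →L[ℂ] H} {p : ℕ → H →L[ℂ] H}
    (hp : ∀ ξ, Tendsto (fun n => p n ξ) atTop (𝓝 ξ))
    (h : ∀ n, RestrictsTo x (e * p n) (v * p n)) : RestrictsTo x e v := fun ξ => by
  have h1 : Tendsto (fun n => (e (p n ξ), v (p n ξ))) atTop (𝓝 (e ξ, v ξ)) :=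
    ((e.continuous.tendsto _).comp (hp ξ)).prodMk_nhds ((v.continuous.tendsto _).comp (hp ξ))
  exact IsClosed.mem_of_tendsto hx h1 (Eventually.of_forall fun n => h n ξ)

theorem eq_zero_of_tendsto (hx : x.IsClosed) {p : ℕ → H →L[ℂ] H}
    (hp : ∀ ξ, Tendsto (fun n => p n ξ) atTop (𝓝 ξ))
    (h : ∀ n, RestrictsTo x (p n) 0) : x = 0 := by
  rw [← ofBounded_zero]
  refine eq_ofBounded (of_tendsto hx hp fun n => ?_)
  rw [one_mul, zero_mul]
  exact h n

end RestrictsTo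

theorem strongAdd_ofBounded (a b : H →L[ℂ] H) :
    strongAdd (ofBounded a) (ofBounded b) = ofBounded (a + b) :=
  eq_ofBounded <| by simpa using (RestrictsTo.ofBounded a 1).strongAdd (RestrictsTo.ofBounded b 1)

theorem strongSMul_ofBounded (k : ℂ) (a : H →L[ℂ] H) :
    strongSMul k (ofBounded a) = ofBounded (k • a) :=
  eq_ofBounded <| by simpa using (RestrictsTo.ofBounded a 1).strongSMul k

theorem strongMul_ofBounded {x : H →ₗ.[ℂ] H} {r a : H →L[ℂ] H} (h : RestrictsTo x r a) :
    strongMul x (ofBounded r) = ofBounded a :=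
  eq_ofBounded <| (RestrictsTo.ofBounded r 1).strongMul (by simpa using h)

/-! ### Exhaustion of measurable operators by bounded ones -/

/-- A sequence of projections of `M` that converges strongly to `1`, on which `x` is bounded. -/
structure IsExhaustion (M : VonNeumannAlgebra H) (x : H →ₗ.[ℂ] H) (p : ℕ → H →L[ℂ] H) : Prop where
  isProj : ∀ n, IsProj M (p n)
  tendsto : ∀ ξ, Tendsto (fun n => p n ξ) atTop (𝓝 ξ)
  bounded : ∀ n, ∃ a ∈ M, RestrictsTo x (p n) a

/-- Boundedness of `x p` is the closed graph theorem; membership in `M` is affiliation together with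
`p ∈ M`. -/
theorem IsMeasurableOperator.exists_restrictsTo {x : H →ₗ.[ℂ] H} (hx : IsMeasurableOperator M x)
    {p : H →L[ℂ] H} (hp : IsProj M p) (hdom : ∀ ξ, p ξ ∈ x.domain) :
    ∃ a ∈ M, RestrictsTo x p a := by
  let f : H →ₗ[ℂ] H := x.toFun.comp ((p : H →ₗ[ℂ] H).codRestrict x.domain hdom)
  have hf : ∀ ξ, (p ξ, f ξ) ∈ x.graph := fun ξ => LinearPMap.mem_graph x ⟨p ξ, hdom ξ⟩
  have hgr : IsClosed (f.graph : Set (H × H)) := by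
    have : (f.graph : Set (H × H)) = (fun q : H × H => (p q.1, q.2)) ⁻¹' (x.graph : Set (H × H)) := by
      ext ⟨ξ, η⟩
      change η = f ξ ↔ (p ξ, η) ∈ x.graph
      constructor
      · rintro rfl
        exact hf ξ
      · intro h
        exact LinearPMap.mem_graph_snd_inj x h (hf ξ) rfl
    rw [this]
    exact hx.isClosed.preimage (by fun_prop)
  let a : H →L[ℂ] H := ContinuousLinearMap.ofIsClosedGraph hgr
  refine ⟨a, mem_of_commute_unitary fun u hu hu' => ?_, hf⟩
  ext ξ
  obtain ⟨h, e⟩ := hx.affiliated u hu hu' ⟨p ξ, hdom ξ⟩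
  have h1 : u (p ξ) = p (u ξ) := DFunLike.congr_fun (commute_of_mem_commutant hp.1 hu').eq ξ
  have h2 : (u (p ξ), u (f ξ)) ∈ x.graph := (LinearPMap.mem_graph_iff x).2 ⟨⟨_, h⟩, rfl, e⟩
  rw [h1] at h2
  exact LinearPMap.mem_graph_snd_inj x h2 (hf (u ξ)) rfl

theorem IsMeasurableOperator.exists_isExhaustion {x : H →ₗ.[ℂ] H}
    (hx : IsMeasurableOperator M x) : ∃ p, IsExhaustion M x p := by
  obtain ⟨p, hp, _, hlim, hdom, _⟩ := hx.domain
  exact ⟨p, hp, hlim, fun n => hx.exists_restrictsTo (hp n) (hdom n)⟩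

/-- The projections commute and are contractions, so their products are projections that still
converge strongly to `1`. This makes `x` and `y` bounded on a common sequence. -/
theorem IsExhaustion.mul (hM : IsAbelian M) {x y : H →ₗ.[ℂ] H} {p q : ℕ → H →L[ℂ] H}
    (hp : IsExhaustion M x p) (hq : IsExhaustion M y q) :
    IsExhaustion M x (fun n => p n * q n) ∧ IsExhaustion M y (fun n => p n * q n) := by
  have h1 : ∀ n, IsProj M (p n * q n) := fun n => (hp.isProj n).mul hM (hq.isProj n)
  have h2 : ∀ ξ, Tendsto (fun n => (p n * q n) ξ) atTop (𝓝 ξ) := fun ξ => by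
    have h3 : Tendsto (fun n => p n (q n ξ - ξ)) atTop (𝓝 0) := by
      refine squeeze_zero_norm (a := fun n => ‖q n ξ - ξ‖) (fun n => ?_) ?_
      · exact (p n).le_of_opNorm_le (hp.isProj n).2.norm_le _ |>.trans (by rw [one_mul])
      · exact tendsto_iff_norm_sub_tendsto_zero.1 (hq.tendsto ξ)
    have := h3.add (hp.tendsto ξ)
    rw [zero_add] at this
    refine this.congr fun n => ?_
    rw [← _root_.map_add, sub_add_cancel]
    rfl
  refine ⟨⟨h1, h2, fun n => ?_⟩, ⟨h1, h2, fun n => ?_⟩⟩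
  · obtain ⟨a, ha, hr⟩ := hp.bounded n
    exact ⟨a * q n, mul_mem ha (hq.isProj n).1, hr.mul_right _⟩
  · obtain ⟨a, ha, hr⟩ := hq.bounded n
    refine ⟨a * p n, mul_mem ha (hp.isProj n).1, ?_⟩
    have : p n * q n = q n * p n := hM _ (hp.isProj n).1 _ (hq.isProj n).1
    rw [this]
    exact hr.mul_right _

/-! ### The resolvent of `|x|²` -/

theorem truncPow_antitone {p : ℝ} (hp : 0 ≤ p) (n : ℕ) : Antitone (truncPow p n) := by
  intro t t' h
  unfold truncPow
  have h0 : (0 : ℝ) < 1 / (1 + (n : ℝ) ^ 2) := by positivity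
  have h1 : 0 < max t (1 / (1 + (n : ℝ) ^ 2)) := lt_max_of_lt_right h0
  gcongr

theorem truncPow_nonneg (p : ℝ) (n : ℕ) (t : ℝ) : 0 ≤ truncPow p n t :=
  Real.rpow_nonneg (Real.sqrt_nonneg _) _

section Resolvent

variable {x : H →ₗ.[ℂ] H} {B : H →L[ℂ] H}

/-- The defining identity tested on `B ξ` reads `⟪ξ, B ξ⟫ = ‖B ξ‖² + ‖x (B ξ)‖²`. -/
theorem IsAbsResolvent.nonneg (hd : Dense (x.domain : Set H)) (hB : IsAbsResolvent x B) :
    0 ≤ B := by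
  rw [ContinuousLinearMap.nonneg_iff_isPositive, ContinuousLinearMap.isPositive_def']
  refine ⟨hB.isSelfAdjoint hd, fun ξ => ?_⟩
  obtain ⟨h, e⟩ := hB.inner hd ξ
  have h1 := e ⟨B ξ, h⟩
  have h2 := congrArg Complex.re h1
  rw [inner_self_eq_norm_sq_to_K, inner_self_eq_norm_sq_to_K] at h2
  have h3 : (⟪ξ, B ξ⟫_ℂ).re = ‖B ξ‖ ^ 2 + ‖x ⟨B ξ, h⟩‖ ^ 2 := by exact_mod_cast h2
  have h4 : B.reApplyInnerSelf ξ = (⟪ξ, B ξ⟫_ℂ).re := by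
    rw [ContinuousLinearMap.reApplyInnerSelf_apply, ← inner_re_symm]
    rfl
  rw [h4, h3]
  positivity

/-- For a unitary `u` of the commutant, `u⋆ B u` satisfies the same weak equation as `B`, and that
equation has only one solution. -/
theorem IsAbsResolvent.mem (hd : Dense (x.domain : Set H)) (hx : IsAffiliated M x)
    (hB : IsAbsResolvent x B) : B ∈ M := by
  refine mem_of_commute_unitary fun u hu hu' => ?_
  have hus : star u ∈ unitary (H →L[ℂ] H) := Unitary.star_mem hu
  have hus' : star u ∈ M.commutant := star_mem hu'
  have huu : ∀ ξ, u (star u ξ) = ξ := fun ξ => DFunLike.congr_fun (Unitary.mem_iff.1 hu).2 ξ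
  have hadj : ∀ ξ η, ⟪star u ξ, η⟫_ℂ = ⟪ξ, u η⟫_ℂ := fun ξ η =>
    ContinuousLinearMap.adjoint_inner_left u η ξ
  have hiso : ∀ ξ η, ⟪u ξ, u η⟫_ℂ = ⟪ξ, η⟫_ℂ := fun ξ η => by
    rw [← hadj]
    congr 1
    exact DFunLike.congr_fun (Unitary.mem_iff.1 hu).1 ξ
  suffices h : ∀ ξ, star u (B (u ξ)) = B ξ by
    ext ξ
    change u (B ξ) = B (u ξ)
    rw [← h, huu]
  intro ξ
  obtain ⟨h, e⟩ := hB.inner hd ξ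
  obtain ⟨h', e'⟩ := hB.inner hd (u ξ)
  obtain ⟨h'', e''⟩ := hx (star u) hus hus' ⟨B (u ξ), h'⟩
  let δ : x.domain := ⟨star u (B (u ξ)), h''⟩ - ⟨B ξ, h⟩
  have key : ∀ η : x.domain, ⟪ξ, (η : H)⟫_ℂ =
      ⟪star u (B (u ξ)), (η : H)⟫_ℂ + ⟪x ⟨star u (B (u ξ)), h''⟩, x η⟫_ℂ := by
    intro η
    obtain ⟨k, ek⟩ := hx u hu hu' η
    have := e' ⟨u η, k⟩
    rw [ek] at this
    rw [e'', hadj, hadj, ← this, hiso]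
  have hz : ⟪(δ : H), (δ : H)⟫_ℂ + ⟪x δ, x δ⟫_ℂ = 0 := by
    have e1 : (δ : H) = star u (B (u ξ)) - B ξ := rfl
    have e2 : x δ = x ⟨star u (B (u ξ)), h''⟩ - x ⟨B ξ, h⟩ := LinearPMap.map_sub x _ _
    nth_rw 1 [e1]
    nth_rw 1 [e2]
    rw [inner_sub_left, inner_sub_left]
    linear_combination e δ - key δ
  have hre := congrArg Complex.re hz
  rw [inner_self_eq_norm_sq_to_K, inner_self_eq_norm_sq_to_K] at hre
  have hn : ‖(δ : H)‖ ^ 2 + ‖x δ‖ ^ 2 = 0 := by exact_mod_cast hre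
  have : ‖(δ : H)‖ = 0 := by nlinarith [sq_nonneg ‖(δ : H)‖, sq_nonneg ‖x δ‖]
  exact sub_eq_zero.1 (norm_eq_zero.1 this)

/-- This is `(1 + x⋆ x) B = 1` compressed to the range of `e`, where `x` acts as `w`. It translates
bounds on `star w * w` into bounds on `B`. -/
theorem IsAbsResolvent.mul_restrictsTo (hM : IsAbelian M) (hd : Dense (x.domain : Set H))
    (hB : IsAbsResolvent x B) (hBM : B ∈ M) {e w : H →L[ℂ] H} (he : IsProj M e)
    (h : RestrictsTo x e w) : e = B * e + star w * w * B := by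
  have hBe : ∀ ξ, B (e ξ) = e (B ξ) := fun ξ => DFunLike.congr_fun (hM B hBM e he.1) ξ
  ext ξ
  refine ext_inner_right ℂ fun ζ => ?_
  obtain ⟨k, ek⟩ := hB.inner hd (e ξ)
  obtain ⟨v, hv, hv'⟩ := (LinearPMap.mem_graph_iff x).1 (h ζ)
  obtain ⟨v₁, hv₁, hv₁'⟩ := (LinearPMap.mem_graph_iff x).1 (h (B ξ))
  dsimp only at hv hv' hv₁ hv₁'
  have h1 := ek v
  have h2 : (⟨B (e ξ), k⟩ : x.domain) = v₁ := Subtype.ext ((hBe ξ).trans hv₁.symm)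
  rw [h2, hv', hv₁', hv, hBe] at h1
  have hee : ∀ α β, ⟪e α, e β⟫_ℂ = ⟪e α, β⟫_ℂ := fun α β => by
    have h3 : ⟪e α, e β⟫_ℂ = ⟪star e (e α), β⟫_ℂ :=
      (ContinuousLinearMap.adjoint_inner_left e β (e α)).symm
    rw [h3, he.star_eq]
    congr 1
    exact DFunLike.congr_fun he.mul_self α
  rw [hee, hee] at h1
  change ⟪e ξ, ζ⟫_ℂ = ⟪B (e ξ) + star w (w (B ξ)), ζ⟫_ℂ
  rw [inner_add_left, hBe, h1]
  congr 1
  exact (ContinuousLinearMap.adjoint_inner_left w ζ (w (B ξ))).symm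

end Resolvent

theorem truncAbsPow_nonneg (x : H →ₗ.[ℂ] H) (p : ℝ) (n : ℕ) : 0 ≤ truncAbsPow x p n :=
  cfc_nonneg fun t _ => truncPow_nonneg p n t

theorem IsMeasurableOperator.isAbsResolvent {x : H →ₗ.[ℂ] H} (hx : IsMeasurableOperator M x) :
    IsAbsResolvent x (absResolvent x) := absResolvent_spec hx.isClosed hx.dense

theorem IsMeasurableOperator.isPos_absResolvent {x : H →ₗ.[ℂ] H}
    (hx : IsMeasurableOperator M x) : IsPos M (absResolvent x) :=
  ⟨hx.isAbsResolvent.mem hx.dense hx.affiliated, hx.isAbsResolvent.nonneg hx.dense⟩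

theorem IsMeasurableOperator.isPos_truncAbsPow {x : H →ₗ.[ℂ] H} (hx : IsMeasurableOperator M x)
    (p : ℝ) (n : ℕ) : IsPos M (truncAbsPow x p n) := by
  refine ⟨mem_of_commute fun t ht => ?_, truncAbsPow_nonneg x p n⟩
  have h1 := commute_of_mem_commutant hx.isPos_absResolvent.1 ht
  exact (IsSelfAdjoint.commute_cfc (IsSelfAdjoint.of_nonneg hx.isPos_absResolvent.2) h1.symm _).symm

/-- On `e` the hypothesis gives `1 + |x|² ≥ 2 (1 + s²)`, that is `(1 + s²) B ≤ 1/2`. The factor `2`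
leaves room for an affine minorant in `B` in place of a spectral projection of `B`. -/
theorem smul_le_truncAbsPow (hM : IsAbelian M) {x : H →ₗ.[ℂ] H} (hx : IsMeasurableOperator M x)
    {e w : H →L[ℂ] H} (he : IsProj M e) (hw : w ∈ M) (h : RestrictsTo x e w) {s : ℝ} (hs : 0 ≤ s)
    (hle : (1 + 2 * s ^ 2) • e ≤ star w * w) (n : ℕ) :
    (min s n / 2) • e ≤ truncAbsPow x 1 n := by
  have hB := hx.isPos_absResolvent
  have h1 := hx.isAbsResolvent.mul_restrictsTo hM hx.dense hB.1 he h
  have hF := hx.isPos_truncAbsPow 1 n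
  have hn : (0 : ℝ) ≤ n := n.cast_nonneg
  have hm : 0 ≤ min s n := le_min hs hn
  set B := absResolvent x with hBdef
  have hBe : B * e ∈ M := mul_mem hB.1 he.1
  have h2 : (2 * (1 + s ^ 2)) • (B * e) ≤ e := by
    have h3 := hM.mul_le_mul_right (rsmul_mem (1 + 2 * s ^ 2) he.1) (mul_mem (star_mem hw) hw)
      hle hB
    rw [smul_mul_assoc, hM e he.1 B hB.1] at h3
    conv_rhs => rw [h1]
    refine le_trans (le_of_eq ?_) (add_le_add_right h3 (B * e))
    rw [show 2 * (1 + s ^ 2) = 1 + (1 + 2 * s ^ 2) by ring, add_smul _ _ (B * e), one_smul]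
  -- For `t ≤ 1 / (1 + s²)` the truncated power is at least `min s n`, which dominates the affine
  -- function; for larger `t` the affine function is nonpositive.
  have h3 : (min s n) • ((1 : H →L[ℂ] H) - (1 + s ^ 2) • B) ≤ truncAbsPow x 1 n := by
    have h4 : cfc (fun t : ℝ => min s n * (1 - (1 + s ^ 2) * t)) B =
        (min s n) • ((1 : H →L[ℂ] H) - (1 + s ^ 2) • B) := by
      have hsa : IsSelfAdjoint B := IsSelfAdjoint.of_nonneg hB.2
      rw [cfc_const_mul _ _ _, cfc_sub _ _ _, cfc_const_mul _ _ _, cfc_const_one ℝ B, cfc_id' ℝ B]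
    rw [← h4, truncAbsPow]
    refine cfc_mono (fun t ht => ?_) ?_ (continuous_truncPow zero_le_one n).continuousOn
    · have ht0 : 0 ≤ t := spectrum_nonneg_of_nonneg hB.2 ht
      have h5 := truncPow_eq 1 n hs
      rw [Real.rpow_one] at h5
      rcases le_total t (1 / (1 + s ^ 2)) with h6 | h6
      · have h7 := truncPow_antitone zero_le_one n h6
        rw [h5] at h7
        refine le_trans ?_ h7
        refine mul_le_of_le_one_right hm ?_
        have : 0 ≤ (1 + s ^ 2) * t := by positivity
        linarith
      · refine le_trans ?_ (truncPow_nonneg 1 n t)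
        refine mul_nonpos_of_nonneg_of_nonpos hm ?_
        rw [div_le_iff₀ (by positivity)] at h6
        linarith
    · fun_prop
  have hm1 : (min s n) • ((1 : H →L[ℂ] H) - (1 + s ^ 2) • B) ∈ M :=
    rsmul_mem _ (sub_mem (one_mem M) (rsmul_mem _ hB.1))
  have h4 := hM.mul_le_mul_right hm1 hF.1 h3 he.isPos
  have h5 : truncAbsPow x 1 n * e ≤ truncAbsPow x 1 n := by
    have := hM.mul_nonneg hF.1 he.one_sub.1 hF.2 he.one_sub.nonneg
    rwa [mul_sub, mul_one, sub_nonneg] at this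
  refine le_trans ?_ (h4.trans h5)
  have h6 := smul_le_smul_of_nonneg_left h2 (show 0 ≤ min s n / 2 by positivity)
  rw [smul_smul, show min s n / 2 * (2 * (1 + s ^ 2)) = min s n * (1 + s ^ 2) by ring] at h6
  rw [smul_mul_assoc, sub_mul, one_mul, smul_mul_assoc, smul_sub, smul_smul, le_sub_iff_add_le]
  refine (add_le_add_right h6 _).trans (le_of_eq ?_)
  rw [← add_smul]
  congr 1
  ring

/-! ### Bounded elements of the Arens algebra -/

theorem isMeasurableOperator_ofBounded {a : H →L[ℂ] H} (ha : a ∈ M) :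
    IsMeasurableOperator M (ofBounded a) where
  isClosed := isClosed_ofBounded a
  dense := dense_ofBounded a
  affiliated := fun u _ hu ξ =>
    ⟨trivial, DFunLike.congr_fun (commute_of_mem_commutant ha hu).eq.symm (ξ : H)⟩
  domain := by
    refine ⟨fun _ => 1, fun _ => IsProj.one, monotone_const, fun ξ => tendsto_const_nhds,
      fun _ _ => trivial, fun _ => ?_⟩
    rw [sub_self]
    exact ⟨(IsProj.zero (M := M)).1, (IsProj.zero (M := M)).2, fun v _ _ h => le_antisymm h (mul_star_self_nonneg v)⟩

/-- The function is continuous and vanishes at `t = 1`, the value of the resolvent where `x = 0`.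
The affine majorant shows that truncated powers vanish off the support of `x`. -/
theorem truncPow_le_add_mul {p : ℝ} (hp : 0 < p) (n : ℕ) {ε : ℝ} (hε : 0 < ε) :
    ∃ K : ℝ, 0 ≤ K ∧ ∀ t, 0 ≤ t → t ≤ 1 → truncPow p n t ≤ ε + K * (1 - t) := by
  have h1 : truncPow p n 1 = 0 := by
    have := truncPow_eq p n le_rfl
    rw [min_eq_left n.cast_nonneg, Real.zero_rpow hp.ne'] at this
    simpa using this
  obtain ⟨δ, hδ, h2⟩ := Metric.continuous_iff.1 (continuous_truncPow hp.le n) 1 ε hε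
  have h0 := truncPow_nonneg p n 0
  refine ⟨truncPow p n 0 / δ, by positivity, fun t ht0 ht1 => ?_⟩
  rcases lt_or_ge (1 - t) δ with h | h
  · have h3 := h2 t (by rw [Real.dist_eq, abs_sub_comm, abs_of_nonneg (by linarith)]; exact h)
    rw [h1, Real.dist_0_eq_abs] at h3
    have : 0 ≤ truncPow p n 0 / δ * (1 - t) := mul_nonneg (by positivity) (by linarith)
    linarith [le_abs_self (truncPow p n t)]
  · have h3 := truncPow_antitone hp.le n ht0
    have : truncPow p n 0 ≤ truncPow p n 0 / δ * (1 - t) := by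
      rw [div_mul_eq_mul_div, le_div_iff₀ hδ]
      gcongr
    linarith

/-- The spectrum of `B` lies in `[1 / (1 + ‖a‖²), 1]`, which gives the bound `‖a‖ ^ p`. On `1 - E`
the resolvent is `1`, so the truncated power vanishes there. -/
theorem truncAbsPow_ofBounded_le (hM : IsAbelian M) {a E : H →L[ℂ] H} (ha : a ∈ M)
    (hE : IsProj M E) (haE : a * E = a) {p : ℝ} (hp : 0 < p) (n : ℕ) :
    truncAbsPow (ofBounded a) p n ≤ (‖a‖ ^ p) • E := by
  have hx := isMeasurableOperator_ofBounded ha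
  have hB := hx.isPos_absResolvent
  have hF := hx.isPos_truncAbsPow p n
  have hr : RestrictsTo (ofBounded a) 1 a := by simpa using RestrictsTo.ofBounded a 1
  have h1 := hx.isAbsResolvent.mul_restrictsTo hM hx.dense hB.1 IsProj.one hr
  rw [mul_one] at h1
  set B := absResolvent (ofBounded a) with hBdef
  have hsa : IsSelfAdjoint B := IsSelfAdjoint.of_nonneg hB.2
  have haa : star a * a ∈ M := mul_mem (star_mem ha) ha
  have hB1 : B ≤ 1 := by
    rw [h1]
    exact le_add_of_nonneg_right (hM.mul_nonneg haa hB.1 (star_mul_self_nonneg a) hB.2)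
  have h2 : (1 : H →L[ℂ] H) ≤ (1 + ‖a‖ ^ 2) • B := by
    have h3 : star a * a ≤ (‖a‖ ^ 2) • (1 : H →L[ℂ] H) := by
      have := CStarAlgebra.star_mul_le_algebraMap_norm_sq (a := a)
      rwa [Algebra.algebraMap_eq_smul_one] at this
    have h4 := hM.mul_le_mul_right haa (rsmul_mem _ (one_mem M)) h3 hB
    rw [smul_mul_assoc, one_mul] at h4
    rw [add_smul, one_smul]
    conv_lhs => rw [h1]
    exact add_le_add_right h4 _
  have hcont := (continuous_truncPow hp.le n).continuousOn (s := spectrum ℝ B)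
  have hspec : ∀ t ∈ spectrum ℝ B, 1 / (1 + ‖a‖ ^ 2) ≤ t ∧ t ≤ 1 := by
    intro t ht
    constructor
    · have h5 : algebraMap ℝ (H →L[ℂ] H) (1 / (1 + ‖a‖ ^ 2)) ≤ B := by
        rw [Algebra.algebraMap_eq_smul_one]
        have := smul_le_smul_of_nonneg_left h2 (show 0 ≤ 1 / (1 + ‖a‖ ^ 2) by positivity)
        rwa [smul_smul, one_div_mul_cancel (by positivity), one_smul] at this
      exact (algebraMap_le_iff_le_spectrum (a := B)).1 h5 t ht
    · have h5 : B ≤ algebraMap ℝ (H →L[ℂ] H) 1 := by rwa [_root_.map_one]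
      exact (le_algebraMap_iff_spectrum_le (a := B)).1 h5 t ht
  have hbound : truncAbsPow (ofBounded a) p n ≤ (‖a‖ ^ p) • (1 : H →L[ℂ] H) := by
    rw [← Algebra.algebraMap_eq_smul_one, truncAbsPow]
    refine cfc_le_algebraMap _ _ _ fun t ht => ?_
    refine (truncPow_antitone hp.le n (hspec t ht).1).trans ?_
    rw [truncPow_eq p n (norm_nonneg a)]
    exact Real.rpow_le_rpow (le_min (norm_nonneg a) n.cast_nonneg) (min_le_left _ _) hp.le
  have hBE : B * (1 - E) = 1 - E := by
    have h5 : star a * a * B * (1 - E) = 0 := by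
      rw [mul_assoc, hM B hB.1 _ hE.one_sub.1, mul_assoc, ← mul_assoc a, mul_sub, mul_one, haE,
        sub_self, zero_mul, mul_zero]
    have h6 := congrArg (· * (1 - E)) h1
    simp only [add_mul, one_mul, h5, add_zero] at h6
    exact h6.symm
  have hzero : truncAbsPow (ofBounded a) p n * (1 - E) = 0 := by
    rw [← norm_eq_zero]
    refine le_antisymm (le_of_forall_pos_le_add fun ε hε => ?_) (norm_nonneg _)
    rw [zero_add]
    refine norm_le_of_le_smul hE.one_sub
      (hM.mul_nonneg hF.1 hE.one_sub.1 hF.2 hE.one_sub.nonneg) hε.le ?_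
    obtain ⟨K, hK, hKt⟩ := truncPow_le_add_mul hp n hε
    have h7 : truncAbsPow (ofBounded a) p n ≤ ε • (1 : H →L[ℂ] H) + K • (1 - B) := by
      have h8 : cfc (fun t : ℝ => ε + K * (1 - t)) B = ε • (1 : H →L[ℂ] H) + K • (1 - B) := by
        rw [cfc_const_add _ _ _, cfc_const_mul _ _ _, cfc_sub _ _ _, cfc_const_one ℝ B,
          cfc_id' ℝ B, Algebra.algebraMap_eq_smul_one]
      rw [← h8, truncAbsPow]
      refine cfc_mono (fun t ht => ?_) hcont (by fun_prop)
      exact hKt t (le_trans (by positivity) (hspec t ht).1) (hspec t ht).2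
    have h9 : ε • (1 : H →L[ℂ] H) + K • (1 - B) ∈ M :=
      add_mem (rsmul_mem _ (one_mem M)) (rsmul_mem _ (sub_mem (one_mem M) hB.1))
    refine (hM.mul_le_mul_right hF.1 h9 h7 hE.one_sub.isPos).trans (le_of_eq ?_)
    rw [add_mul, smul_mul_assoc, smul_mul_assoc, one_mul, sub_mul, one_mul, hBE, sub_self,
      smul_zero, add_zero]
  have h10 := hM.mul_le_mul_right hF.1 (rsmul_mem _ (one_mem M)) hbound hE.isPos
  rw [smul_mul_assoc, one_mul] at h10
  rw [mul_sub, mul_one, sub_eq_zero] at hzero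
  rwa [← hzero] at h10

theorem ofBounded_mem_arens (hM : IsAbelian M) (hτ : IsFaithfulNormalSemifiniteTrace M τ)
    {a E : H →L[ℂ] H} (ha : a ∈ M) (hE : IsProj M E) (hfin : τ E < ∞) (haE : a * E = a) :
    ofBounded a ∈ arens M τ := by
  refine Set.mem_iInter₂.2 fun p hp => ⟨isMeasurableOperator_ofBounded ha, ?_⟩
  have hc : (0 : ℝ) ≤ ‖a‖ ^ p := Real.rpow_nonneg (norm_nonneg a) p
  refine lt_of_le_of_lt (iSup_le fun n => ?_)
    (ENNReal.mul_lt_top (ENNReal.ofReal_lt_top (r := ‖a‖ ^ p)) hfin)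
  rw [← hτ.map_rsmul hE.isPos hc]
  exact hτ.mono ((isMeasurableOperator_ofBounded ha).isPos_truncAbsPow p n)
    ⟨rsmul_mem _ hE.1, smul_nonneg hc hE.nonneg⟩
    (truncAbsPow_ofBounded_le hM ha hE haE (by linarith) n)

theorem isMeasurableOperator_of_mem_arens {x : H →ₗ.[ℂ] H} (hx : x ∈ arens M τ) :
    IsMeasurableOperator M x := (Set.mem_iInter₂.1 hx 1 le_rfl).1

theorem ofReal_mul_le_traceAbsPow (hM : IsAbelian M) (hτ : IsFaithfulNormalSemifiniteTrace M τ)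
    {x : H →ₗ.[ℂ] H} (hx : IsMeasurableOperator M x)
    {e w : H →L[ℂ] H} (he : IsProj M e) (hw : w ∈ M) (h : RestrictsTo x e w) {s : ℝ} (hs : 0 ≤ s)
    (hle : (1 + 2 * s ^ 2) • e ≤ star w * w) :
    ENNReal.ofReal (s / 2) * τ e ≤ traceAbsPow τ x 1 := by
  obtain ⟨n, hn⟩ := exists_nat_ge s
  have h1 := smul_le_truncAbsPow hM hx he hw h hs hle n
  rw [min_eq_left hn] at h1
  have h2 : 0 ≤ s / 2 := by positivity
  rw [← hτ.map_rsmul he.isPos h2]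
  exact (hτ.mono ⟨rsmul_mem _ he.1, smul_nonneg h2 he.nonneg⟩ (hx.isPos_truncAbsPow 1 n) h1).trans
    (le_iSup (fun n => τ (truncAbsPow x 1 n)) n)

/-! ### Orthogonal sequences of projections -/

/-- Repeated splitting gives a strictly decreasing sequence of projections below `F`; its successive
differences are nonzero and mutually orthogonal. -/
theorem exists_orthogonal_of_no_minimal (hM : IsAbelian M) {F : H →L[ℂ] H} (hF : IsProj M F)
    (hF0 : F ≠ 0) (hsplit : ∀ G, IsProj M G → G * F = G → G ≠ 0 →
      ∃ e, IsProj M e ∧ e * G = e ∧ e ≠ 0 ∧ e ≠ G) :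
    ∃ e : ℕ → H →L[ℂ] H, (∀ k, IsProj M (e k) ∧ e k ≠ 0 ∧ e k * F = e k) ∧
      ∀ j k, j ≠ k → e j * e k = 0 := by
  let S := {G : H →L[ℂ] H // IsProj M G ∧ G * F = G ∧ G ≠ 0}
  have hnext : ∀ G : S, ∃ G' : S, (G' : H →L[ℂ] H) * G = G' ∧ (G' : H →L[ℂ] H) ≠ G := by
    rintro ⟨G, hG, hGF, hG0⟩
    obtain ⟨e, he, heG, he0, hne⟩ := hsplit G hG hGF hG0
    exact ⟨⟨e, he, by rw [← heG, mul_assoc, hGF], he0⟩, heG, hne⟩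
  choose next hn1 hn2 using hnext
  let G : ℕ → S := fun n => Nat.rec ⟨F, hF, hF.mul_self, hF0⟩ (fun _ => next) n
  have hG : ∀ n, (G (n + 1)).1 * (G n).1 = (G (n + 1)).1 := fun n => hn1 (G n)
  have hGne : ∀ n, (G (n + 1)).1 ≠ (G n).1 := fun n => hn2 (G n)
  have hGle : ∀ n k, (G (n + k)).1 * (G n).1 = (G (n + k)).1 := by
    intro n k
    induction k with
    | zero => exact (G n).2.1.mul_self
    | succ k ih =>
      rw [← add_assoc, ← hG (n + k), mul_assoc, ih]
  have hlt : ∀ n m, n < m →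
      ((G m).1 - (G (m + 1)).1) * ((G n).1 - (G (n + 1)).1) = 0 := by
    intro n m h
    obtain ⟨k, rfl⟩ := Nat.exists_eq_add_of_lt h
    have h1 := hGle n (k + 1)
    have h2 := hGle (n + 1) k
    have h3 := hGle n (k + 2)
    have h4 := hGle (n + 1) (k + 1)
    rw [show n + 1 + k = n + k + 1 by ring] at h2
    rw [show n + 1 + (k + 1) = n + k + 1 + 1 by ring] at h4
    rw [← add_assoc] at h1
    rw [show n + (k + 2) = n + k + 1 + 1 by ring] at h3
    rw [sub_mul, mul_sub, mul_sub, h1, h2, h3, h4, sub_self, sub_self, sub_self]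
  have hproj : ∀ n, IsProj M ((G n).1 - (G (n + 1)).1) := fun n =>
    (G n).2.1.sub hM (G (n + 1)).2.1 (hG n)
  refine ⟨fun n => (G n).1 - (G (n + 1)).1, fun n => ⟨hproj n, ?_, ?_⟩, fun j k hjk => ?_⟩
  · exact sub_ne_zero.2 (hGne n).symm
  · rw [sub_mul, (G n).2.2.1, (G (n + 1)).2.2.1]
  · rcases lt_or_gt_of_ne hjk with h | h
    · rw [hM _ (hproj j).1 _ (hproj k).1]
      exact hlt j k h
    · exact hlt k j h

/-- The series `∑ b k * e k` converges in norm by the geometric bound, and orthogonality isolates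
one term under multiplication by `e k`. -/
theorem exists_glue {E : H →L[ℂ] H} {e b : ℕ → H →L[ℂ] H}
    (he : ∀ k, IsProj M (e k)) (horth : ∀ j k, j ≠ k → e j * e k = 0)
    (heE : ∀ k, e k * E = e k) (hb : ∀ k, b k ∈ M) (hn : ∀ k, ‖b k‖ ≤ (1 / 2) ^ k) :
    ∃ g ∈ M, g * E = g ∧ ∀ k, g * e k = b k * e k := by
  have hs : Summable fun k => b k * e k := by
    refine Summable.of_norm_bounded summable_geometric_two fun k => ?_
    refine (norm_mul_le _ _).trans ?_
    calc ‖b k‖ * ‖e k‖ ≤ (1 / 2) ^ k * 1 := by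
          gcongr
          · exact hn k
          · exact (he k).2.norm_le
      _ = (1 / 2) ^ k := mul_one _
  refine ⟨∑' k, b k * e k, ?_, ?_, fun k => ?_⟩
  · refine (isClosed_coe M).mem_of_tendsto hs.hasSum (Eventually.of_forall fun s => ?_)
    exact sum_mem fun k _ => mul_mem (hb k) (he k).1
  · rw [← hs.tsum_mul_right]
    exact tsum_congr fun k => by rw [mul_assoc, heE]
  · rw [← hs.tsum_mul_right, tsum_eq_single k]
    · rw [mul_assoc, (he k).mul_self]
    · intro j hj
      rw [mul_assoc, horth j k hj, mul_zero]

/-! ### Derivations on bounded elements -/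

/-- The derivative of the bounded element `a` restricts to `u` on the range of `r`. -/
def DerivRestrictsTo (d : arens M τ → arens M τ) (a r u : H →L[ℂ] H) : Prop :=
  ∃ h : ofBounded a ∈ arens M τ, RestrictsTo (d ⟨ofBounded a, h⟩ : H →ₗ.[ℂ] H) r u

variable {d : arens M τ → arens M τ} {a b r u v : H →L[ℂ] H}

namespace DerivRestrictsTo

theorem mul_right (h : DerivRestrictsTo d a r u) (s : H →L[ℂ] H) :
    DerivRestrictsTo d a (r * s) (u * s) := ⟨h.1, h.2.mul_right s⟩

theorem unique (h : DerivRestrictsTo d a r u) (h' : DerivRestrictsTo d a r v) : u = v :=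
  h.2.unique h'.2

theorem add (hd : IsArensDerivation M τ d) (h : DerivRestrictsTo d a r u)
    (h' : DerivRestrictsTo d b r v) (hab : ofBounded (a + b) ∈ arens M τ) :
    DerivRestrictsTo d (a + b) r (u + v) := by
  refine ⟨hab, ?_⟩
  rw [hd.map_add ⟨_, h.1⟩ ⟨_, h'.1⟩ ⟨_, hab⟩ (strongAdd_ofBounded a b).symm]
  exact h.2.strongAdd h'.2

theorem smul (hd : IsArensDerivation M τ d) (h : DerivRestrictsTo d a r u) (k : ℂ)
    (hk : ofBounded (k • a) ∈ arens M τ) : DerivRestrictsTo d (k • a) r (k • u) := by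
  refine ⟨hk, ?_⟩
  rw [hd.map_smul k ⟨_, h.1⟩ ⟨_, hk⟩ (strongSMul_ofBounded k a).symm]
  exact h.2.strongSMul k

end DerivRestrictsTo

theorem isMeasurableOperator_deriv (d : arens M τ → arens M τ) (x : arens M τ) :
    IsMeasurableOperator M (d x : H →ₗ.[ℂ] H) := isMeasurableOperator_of_mem_arens (d x).2

/-- On each bounded piece `b` of the derivative, Leibniz for `e = e * e` gives `b = 2 b e`.
Multiplying by `e` gives `b e = 0`, hence `b = 0`. -/
theorem deriv_isProj (hM : IsAbelian M) (hd : IsArensDerivation M τ d) {e : H →L[ℂ] H}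
    (he : IsProj M e) (hmem : ofBounded e ∈ arens M τ) :
    (d ⟨ofBounded e, hmem⟩ : H →ₗ.[ℂ] H) = 0 := by
  obtain ⟨p, hp⟩ := (isMeasurableOperator_deriv d ⟨ofBounded e, hmem⟩).exists_isExhaustion
  refine RestrictsTo.eq_zero_of_tendsto
    (isMeasurableOperator_deriv d ⟨ofBounded e, hmem⟩).isClosed hp.tendsto fun n => ?_
  obtain ⟨b, hb, hr⟩ := hp.bounded n
  have h1 := hd.leibniz ⟨_, hmem⟩ ⟨_, hmem⟩ ⟨_, hmem⟩ (by
    rw [strongMul_ofBounded (RestrictsTo.ofBounded e e), he.mul_self])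
  have h2 := hr.mul_right e
  rw [hM _ (hp.isProj n).1 e he.1] at h2
  have h3 := ((RestrictsTo.ofBounded e (p n)).strongMul h2).strongAdd
    (hr.strongMul (RestrictsTo.ofBounded e b))
  rw [← h1] at h3
  have h4 : b = b * e + b * e := by
    conv_rhs => rw [hM b hb e he.1]
    rw [hM b hb e he.1] at h3
    exact hr.unique h3
  have h5 : b * e = 0 := by
    have h6 : b * e = b * e + b * e := by
      conv_lhs => rw [h4]
      rw [add_mul, mul_assoc, he.mul_self]
    simpa using h6
  rw [h5, add_zero] at h4
  rwa [h4] at hr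

theorem restrictsTo_zero (r : H →L[ℂ] H) : RestrictsTo (0 : H →ₗ.[ℂ] H) r 0 := by
  rw [← ofBounded_zero]
  simpa using RestrictsTo.ofBounded 0 r

theorem DerivRestrictsTo.of_isProj (hM : IsAbelian M) (hd : IsArensDerivation M τ d)
    {e : H →L[ℂ] H} (he : IsProj M e) (hmem : ofBounded e ∈ arens M τ) (r : H →L[ℂ] H) :
    DerivRestrictsTo d e r 0 := by
  refine ⟨hmem, ?_⟩
  rw [deriv_isProj hM hd he hmem]
  exact restrictsTo_zero r

/-- This is `d (x e) = (d x) e`. Only `x e` has to be bounded, so it also applies to unbounded `x`.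
-/
theorem deriv_strongMul_isProj (hM : IsAbelian M) (hd : IsArensDerivation M τ d) {x : arens M τ}
    {e r a u : H →L[ℂ] H} (he : IsProj M e) (hmem : ofBounded e ∈ arens M τ)
    (hxa : RestrictsTo (x : H →ₗ.[ℂ] H) e a) (hae : ofBounded a ∈ arens M τ) (hr : r ∈ M)
    (hu : RestrictsTo (d x : H →ₗ.[ℂ] H) r u) :
    DerivRestrictsTo d a r (u * e) := by
  refine ⟨hae, ?_⟩
  rw [hd.leibniz x ⟨_, hmem⟩ ⟨_, hae⟩ (strongMul_ofBounded hxa).symm]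
  have h1 := hu.mul_right e
  rw [hM r hr e he.1] at h1
  -- The second Leibniz term is `x` applied after `d e = 0`, so only the value of `x` at the zero
  -- vector matters.
  have h2 : RestrictsTo (x : H →ₗ.[ℂ] H) 0 0 := by simpa using hxa.mul_right 0
  have h3 := ((RestrictsTo.ofBounded e r).strongMul h1).strongAdd
    ((DerivRestrictsTo.of_isProj hM hd he hmem r).2.strongMul h2)
  rwa [add_zero] at h3

theorem DerivRestrictsTo.mul_isProj (hM : IsAbelian M) (hd : IsArensDerivation M τ d)
    {e : H →L[ℂ] H} (he : IsProj M e) (hmem : ofBounded e ∈ arens M τ)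
    (hae : ofBounded (a * e) ∈ arens M τ) (hr : r ∈ M) (h : DerivRestrictsTo d a r u) :
    DerivRestrictsTo d (a * e) r (u * e) :=
  deriv_strongMul_isProj (x := ⟨ofBounded a, h.1⟩) hM hd he hmem (RestrictsTo.ofBounded a e) hae hr h.2

/-! ### Bounded elements supported on a projection of finite trace -/

section Corner

variable {E : H →L[ℂ] H}

theorem DerivRestrictsTo.of_mem_span (hM : IsAbelian M)
    (hτ : IsFaithfulNormalSemifiniteTrace M τ) (hd : IsArensDerivation M τ d) (hE : IsProj M E)
    (hfin : τ E < ∞) (r : H →L[ℂ] H) {s : H →L[ℂ] H}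
    (hs : s ∈ Submodule.span ℂ {e | IsProj M e ∧ e * E = e}) :
    s ∈ M ∧ s * E = s ∧ DerivRestrictsTo d s r 0 := by
  have hmem : ∀ a ∈ M, a * E = a → ofBounded a ∈ arens M τ := fun a ha haE =>
    ofBounded_mem_arens hM hτ ha hE hfin haE
  induction hs using Submodule.span_induction with
  | mem e he => exact ⟨he.1.1, he.2, DerivRestrictsTo.of_isProj hM hd he.1 (hmem e he.1.1 he.2) r⟩
  | zero =>
    have h0 : IsProj M (0 : H →L[ℂ] H) := IsProj.zero
    have h1 : (0 : H →L[ℂ] H) * E = 0 := zero_mul E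
    exact ⟨h0.1, h1, DerivRestrictsTo.of_isProj hM hd h0 (hmem 0 h0.1 h1) r⟩
  | add x y _ _ hx hy =>
    have h1 : x + y ∈ M := add_mem hx.1 hy.1
    have h2 : (x + y) * E = x + y := by rw [add_mul, hx.2.1, hy.2.1]
    refine ⟨h1, h2, ?_⟩
    have h3 := hx.2.2.add hd hy.2.2 (hmem _ h1 h2)
    rwa [add_zero] at h3
  | smul k x _ hx =>
    have h1 : k • x ∈ M := csmul_mem k hx.1
    have h2 : (k • x) * E = k • x := by rw [smul_mul_assoc, hx.2.1]
    refine ⟨h1, h2, ?_⟩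
    have h3 := hx.2.2.smul hd k (hmem _ h1 h2)
    rwa [smul_zero] at h3

/-- Combinations of projections have derivative zero, so `a` can be replaced by a remainder of tiny
norm without changing its derivative. -/
theorem DerivRestrictsTo.congr_of_sub_mem_span (hM : IsAbelian M)
    (hτ : IsFaithfulNormalSemifiniteTrace M τ) (hd : IsArensDerivation M τ d) (hE : IsProj M E)
    (hfin : τ E < ∞) (hb : b ∈ M) (hbE : b * E = b) (h : DerivRestrictsTo d a r u)
    (hs : a - b ∈ Submodule.span ℂ {e | IsProj M e ∧ e * E = e}) :
    DerivRestrictsTo d b r u := by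
  have h1 := DerivRestrictsTo.of_mem_span hM hτ hd hE hfin r (neg_mem hs)
  have h2 : b = a + -(a - b) := by abel
  have h3 : ofBounded (a + -(a - b)) ∈ arens M τ := by
    rw [← h2]
    exact ofBounded_mem_arens hM hτ hb hE hfin hbE
  have h4 := h.add hd h1.2.2 h3
  rwa [← h2, add_zero] at h4

/-- Under an atom `F` every projection becomes `0` or `F`. Thus `a * F` is a norm limit of multiples
of `F`, and the line through `F` is closed. -/
theorem exists_mul_eq_smul_of_minimal (hM : IsAbelian M) (hE : IsProj M E) (ha : a ∈ M)
    (ha0 : 0 ≤ a) (haE : a * E = a) {F : H →L[ℂ] H} (hF : IsProj M F)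
    (hmin : ∀ e, IsProj M e → e * F = e → e = 0 ∨ e = F) : ∃ k : ℂ, a * F = k • F := by
  have haE' : a ≤ ‖a‖ • E := by
    have := hM.mul_le_mul_right ha (rsmul_mem _ (one_mem M))
      (le_norm_smul_one (IsSelfAdjoint.of_nonneg ha0)) hE.isPos
    rwa [haE, smul_mul_assoc, one_mul] at this
  have hspan : ∀ s ∈ Submodule.span ℂ {e | IsProj M e ∧ e * E = e},
      s * F ∈ Submodule.span ℂ {F} := by
    intro s hs
    induction hs using Submodule.span_induction with
    | mem e he =>
      have h1 := he.1.mul hM hF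
      rcases hmin (e * F) h1 (by rw [mul_assoc, hF.mul_self]) with h | h
      · rw [h]; exact zero_mem _
      · rw [h]; exact Submodule.mem_span_singleton_self F
    | zero => rw [zero_mul]; exact zero_mem _
    | add x y _ _ hx hy => rw [add_mul]; exact add_mem hx hy
    | smul k x _ hx => rw [smul_mul_assoc]; exact Submodule.smul_mem _ k hx
  have hcl : IsClosed (Submodule.span ℂ {F} : Set (H →L[ℂ] H)) :=
    Submodule.closed_of_finiteDimensional _
  have hmem : a * F ∈ (Submodule.span ℂ {F} : Set (H →L[ℂ] H)) := by
    rw [← hcl.closure_eq, Metric.mem_closure_iff]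
    intro δ hδ
    obtain ⟨n, hn⟩ := exists_pow_lt_of_lt_one (show 0 < δ / (‖a‖ + 1) by positivity)
      (show (1 / 2 : ℝ) < 1 by norm_num)
    obtain ⟨b, hb, hb0, hbc, hbE, hs⟩ := hM.exists_approx ha ha0 hE haE haE' n
    refine ⟨(a - b) * F, hspan _ hs, ?_⟩
    rw [dist_eq_norm, ← sub_mul, sub_sub_cancel]
    have h1 : ‖b‖ ≤ ‖a‖ / 2 ^ n := norm_le_of_le_smul hE hb0 (by positivity) hbc
    calc ‖b * F‖ ≤ ‖b‖ * ‖F‖ := norm_mul_le _ _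
      _ ≤ ‖b‖ * 1 := by gcongr; exact hF.2.norm_le
      _ ≤ ‖a‖ / 2 ^ n := by rwa [mul_one]
      _ = (1 / 2) ^ n * ‖a‖ := by rw [one_div_pow]; ring
      _ ≤ (1 / 2) ^ n * (‖a‖ + 1) := by gcongr; linarith
      _ < δ := by rwa [lt_div_iff₀ (by positivity)] at hn
  obtain ⟨k, hk⟩ := Submodule.mem_span_singleton.1 hmem
  exact ⟨k, hk.symm⟩

end Corner

/-! ### The gluing contradiction and the vanishing of the derivation -/

variable {E F : H →L[ℂ] H}

theorem RestrictsTo.exists_isProj_smul_le (hM : IsAbelian M) {x : H →ₗ.[ℂ] H}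
    (hr : IsProj M r) (hu : u ∈ M) (hu0 : u ≠ 0) (h : RestrictsTo x r u) :
    ∃ F, IsProj M F ∧ F ≠ 0 ∧ F * r = F ∧ ∃ ε : ℝ, 0 < ε ∧ ε • F ≤ star u * u := by
  have hpos : IsPos M (star u * u) := ⟨mul_mem (star_mem hu) hu, star_mul_self_nonneg u⟩
  obtain ⟨F, hF, hF0, ε, hε, hle⟩ := hM.exists_isProj_smul_le hpos
    (by rwa [Ne, CStarRing.star_mul_self_eq_zero_iff])
  have hur : u * r = u := by
    have := h.mul_right r
    rw [hr.mul_self] at this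
    exact this.unique h
  exact ⟨F, hF, hF0, eq_of_smul_le hM hF hr hpos.1 (by rw [mul_assoc, hur]) hε hle, ε, hε, hle⟩

theorem eq_zero_of_smul_le {e w : H →L[ℂ] H} {ε : ℝ} (hM : IsAbelian M) (hF : IsProj M F)
    (hw : w ∈ M) (hε : 0 < ε) (hle : ε • F ≤ star w * w) (he : IsProj M e) (heF : e * F = e)
    (hwe : w * e = 0) : e = 0 := by
  have h1 := hM.mul_le_mul_right (rsmul_mem ε hF.1) (mul_mem (star_mem hw) hw) hle he.isPos
  rw [mul_assoc, hwe, mul_zero, smul_mul_assoc, hM F hF.1 e he.1, heF] at h1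
  refine le_antisymm ?_ he.nonneg
  have := smul_le_smul_of_nonneg_left h1 (inv_nonneg.2 hε.le)
  rwa [smul_smul, inv_mul_cancel₀ hε.ne', one_smul, smul_zero] at this

theorem smul_le_star_mul_of_smul_le {e w : H →L[ℂ] H} {ε : ℝ} (hM : IsAbelian M)
    (hF : IsProj M F) (hw : w ∈ M) (hle : ε • F ≤ star w * w) (he : IsProj M e)
    (heF : e * F = e) (c : ℝ) :
    (c ^ 2 * ε) • e ≤ star ((c : ℂ) • (w * e)) * ((c : ℂ) • (w * e)) := by
  have h1 := hM.mul_le_mul_right (rsmul_mem ε hF.1) (mul_mem (star_mem hw) hw) hle he.isPos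
  rw [smul_mul_assoc, hM F hF.1 e he.1, heF] at h1
  have h2 : star ((c : ℂ) • (w * e)) * ((c : ℂ) • (w * e)) = c ^ 2 • (star w * w * e) := by
    have h3 : e * (star w * (w * e)) = star w * w * e := by
      rw [← mul_assoc (star w), ← mul_assoc, hM e he.1 _ (mul_mem (star_mem hw) hw), mul_assoc,
        he.mul_self]
    rw [Complex.coe_smul, star_smul, star_mul, he.star_eq, star_trivial, smul_mul_assoc,
      mul_smul_comm, smul_smul, mul_assoc, h3, pow_two]
  rw [h2, mul_smul]
  exact smul_le_smul_of_nonneg_left h1 (sq_nonneg c)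

/-- On a minimal `G`, `a * G` would be a multiple of `G` and have derivative zero, so `u * G = 0`,
against `star u * u ≥ ε` on `G`. -/
theorem DerivRestrictsTo.exists_splitting (hM : IsAbelian M)
    (hτ : IsFaithfulNormalSemifiniteTrace M τ) (hd : IsArensDerivation M τ d) (hE : IsProj M E)
    (hfin : τ E < ∞) (ha : a ∈ M) (ha0 : 0 ≤ a) (haE : a * E = a) (hr : IsProj M r) (hu : u ∈ M)
    (h : DerivRestrictsTo d a r u) {ε : ℝ} (hε : 0 < ε) (hF : IsProj M F) (hFE : F * E = F)
    (hle : ε • F ≤ star u * u) {G : H →L[ℂ] H} (hG : IsProj M G) (hGF : G * F = G)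
    (hG0 : G ≠ 0) : ∃ e, IsProj M e ∧ e * G = e ∧ e ≠ 0 ∧ e ≠ G := by
  by_contra! hcon
  have hmem : ∀ a ∈ M, a * E = a → ofBounded a ∈ arens M τ := fun a ha haE =>
    ofBounded_mem_arens hM hτ ha hE hfin haE
  have hGE : G * E = G := by rw [← hGF, mul_assoc, hFE]
  have hGm := hmem G hG.1 hGE
  obtain ⟨k, hk⟩ := exists_mul_eq_smul_of_minimal hM hE ha ha0 haE hG
    (fun e he heG => or_iff_not_imp_left.2 fun h0 => hcon e he heG h0)
  have h1 := h.mul_isProj hM hd hG hGm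
    (hmem _ (mul_mem ha hG.1) (by rw [mul_assoc, hGE])) hr.1
  have h2 := (DerivRestrictsTo.of_isProj hM hd hG hGm r).smul hd k
    (hmem _ (csmul_mem k hG.1) (by rw [smul_mul_assoc, hGE]))
  rw [smul_zero, ← hk] at h2
  exact hG0 (eq_zero_of_smul_le hM hF hu hε hle hG hGF (h1.unique h2))

/-- The pieces of `d g` are a priori known only on an exhaustion `p n`. There `d (g e) = (d g) e`
identifies them with `v * p n`, and closedness of `d g` removes `p n`. -/
theorem DerivRestrictsTo.glue_restrictsTo (hM : IsAbelian M)
    (hτ : IsFaithfulNormalSemifiniteTrace M τ) (hd : IsArensDerivation M τ d) (hE : IsProj M E)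
    (hfin : τ E < ∞) (hr : IsProj M r) {e g : H →L[ℂ] H} (he : IsProj M e)
    (heE : e * E = e) (her : e * r = e) (hg : g ∈ M)
    (hge : ofBounded g ∈ arens M τ) (h : DerivRestrictsTo d (g * e) r v) :
    RestrictsTo (d ⟨ofBounded g, hge⟩ : H →ₗ.[ℂ] H) e v := by
  have hmem : ∀ a ∈ M, a * E = a → ofBounded a ∈ arens M τ := fun a ha haE =>
    ofBounded_mem_arens hM hτ ha hE hfin haE
  have hz := isMeasurableOperator_deriv d ⟨ofBounded g, hge⟩
  obtain ⟨p, hp⟩ := hz.exists_isExhaustion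
  refine RestrictsTo.of_tendsto hz.isClosed hp.tendsto fun n => ?_
  obtain ⟨w, hw, hrw⟩ := hp.bounded n
  have hpn := hp.isProj n
  have h1 : DerivRestrictsTo d g (p n) w := ⟨hge, hrw⟩
  have h2 := (h1.mul_isProj hM hd he (hmem e he.1 heE)
    (hmem _ (mul_mem hg he.1) (by rw [mul_assoc, heE])) hpn.1).mul_right r
  have h3 := h.mul_right (p n)
  rw [hM r hr.1 _ hpn.1] at h3
  have h4 := h2.unique h3
  rw [mul_assoc, her] at h4
  have h5 := hrw.mul_right e
  rwa [hM _ hpn.1 e he.1, h4] at h5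

/-- The heart of the proof: a nonzero derivative, amplified along an orthogonal sequence while the
argument stays bounded, would leave `L¹`. -/
theorem deriv_nonneg_eq_zero (hM : IsAbelian M) (hτ : IsFaithfulNormalSemifiniteTrace M τ)
    (hd : IsArensDerivation M τ d) (hE : IsProj M E) (hfin : τ E < ∞) (ha : a ∈ M) (ha0 : 0 ≤ a)
    (haE : a * E = a) (hae : ofBounded a ∈ arens M τ) :
    (d ⟨ofBounded a, hae⟩ : H →ₗ.[ℂ] H) = 0 := by
  have hmem : ∀ a ∈ M, a * E = a → ofBounded a ∈ arens M τ := fun a ha haE =>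
    ofBounded_mem_arens hM hτ ha hE hfin haE
  have hy := isMeasurableOperator_deriv d ⟨ofBounded a, hae⟩
  obtain ⟨p, hp⟩ := hy.exists_isExhaustion
  refine RestrictsTo.eq_zero_of_tendsto hy.isClosed hp.tendsto fun n => ?_
  obtain ⟨u, hu, hru⟩ := hp.bounded n
  have hr := hp.isProj n
  generalize p n = r at hru hr
  by_cases hu0 : u = 0
  · rwa [hu0] at hru
  exfalso
  have hD : DerivRestrictsTo d a r u := ⟨hae, hru⟩
  obtain ⟨F, hF, hF0, hFr, ε, hε, hle⟩ := hru.exists_isProj_smul_le hM hr hu hu0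
  -- Since `a = a E`, also `d a = (d a) E`; so the derivative lives under `E`.
  have hFE : F * E = F := by
    refine eq_of_smul_le hM hF hE (mul_mem (star_mem hu) hu) ?_ hε hle
    have h1 := hD.mul_isProj hM hd hE (hmem E hE.1 hE.mul_self) (by rwa [haE]) hr.1
    rw [haE] at h1
    rw [mul_assoc, h1.unique hD]
  obtain ⟨e, he, horth⟩ := exists_orthogonal_of_no_minimal hM hF hF0 fun G hG hGF hG0 =>
    hD.exists_splitting hM hτ hd hE hfin ha ha0 haE hr hu hε hF hFE hle hG hGF hG0
  have heE : ∀ k, e k * E = e k := fun k => by rw [← (he k).2.2, mul_assoc, hFE]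
  have her : ∀ k, e k * r = e k := fun k => by rw [← (he k).2.2, mul_assoc, hFr]
  have haE' : a ≤ ‖a‖ • E := by
    have := hM.mul_le_mul_right ha (rsmul_mem _ (one_mem M))
      (le_norm_smul_one (IsSelfAdjoint.of_nonneg ha0)) hE.isPos
    rwa [haE, smul_mul_assoc, one_mul] at this
  have hτe : ∀ k, 0 < (τ (e k)).toReal ∧ τ (e k) = ENNReal.ofReal (τ (e k)).toReal := fun k => by
    have h1 : τ (e k) ≤ τ E := hτ.mono (he k).1.isPos hE.isPos
      ((he k).1.2.le_of_mul_eq_left hE.2 (heE k))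
    have h2 : τ (e k) ≠ 0 := fun h0 => (he k).2.1 (hτ.faithful _ (he k).1.isPos h0)
    have h3 : τ (e k) ≠ ∞ := (h1.trans_lt hfin).ne
    exact ⟨ENNReal.toReal_pos h2 h3, (ENNReal.ofReal_toReal h3).symm⟩
  -- Chosen so that the lower bound `s k / 2 * τ (e k)` for the trace equals `k`.
  let s : ℕ → ℝ := fun k => 2 * k / (τ (e k)).toReal
  have hs : ∀ k, 0 ≤ s k := fun k => by have := (hτe k).1; positivity
  -- The amplification that lifts `ε` to `c k ^ 2 * ε = 1 + 2 * s k ^ 2`, the threshold of the trace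
  -- estimate.
  let c : ℕ → ℝ := fun k => √((1 + 2 * s k ^ 2) / ε)
  have hc : ∀ k, c k ^ 2 * ε = 1 + 2 * s k ^ 2 := fun k => by
    rw [Real.sq_sqrt (by positivity), div_mul_cancel₀ _ hε.ne']
  have hb : ∀ k, ∃ b ∈ M, b * E = b ∧ ‖((c k : ℝ) : ℂ) • b‖ ≤ (1 / 2) ^ k ∧
      DerivRestrictsTo d b r u := fun k => by
    -- `n` is large enough to absorb the amplification `c k`; the added ones keep the denominator
    -- positive.
    obtain ⟨n, hn⟩ := exists_pow_lt_of_lt_one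
      (show 0 < (1 / 2) ^ k / ((c k + 1) * (‖a‖ + 1)) by positivity)
      (show (1 / 2 : ℝ) < 1 by norm_num)
    obtain ⟨b, hb, hb0, hbc, hbE, hs⟩ := hM.exists_approx ha ha0 hE haE haE' n
    refine ⟨b, hb, hbE, ?_, hD.congr_of_sub_mem_span hM hτ hd hE hfin hb hbE hs⟩
    have h1 : ‖b‖ ≤ ‖a‖ / 2 ^ n := norm_le_of_le_smul hE hb0 (by positivity) hbc
    have hc0 : 0 ≤ c k := Real.sqrt_nonneg _
    rw [norm_smul, Complex.norm_real, Real.norm_of_nonneg hc0]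
    calc c k * ‖b‖ ≤ (c k + 1) * ((‖a‖ + 1) / 2 ^ n) := by
          gcongr
          · linarith
          · refine h1.trans ?_
            gcongr
            linarith
      _ = (1 / 2) ^ n * ((c k + 1) * (‖a‖ + 1)) := by rw [one_div_pow]; ring
      _ ≤ (1 / 2) ^ k := by rw [lt_div_iff₀ (by positivity)] at hn; exact hn.le
  choose b hb hbE hbn hbD using hb
  obtain ⟨g, hg, hgE, hge⟩ := exists_glue (fun k => (he k).1) horth heE
    (fun k => csmul_mem (M := M) ((c k : ℝ) : ℂ) (hb k)) hbn
  have hgm := hmem g hg hgE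
  have hres : ∀ k, RestrictsTo (d ⟨ofBounded g, hgm⟩ : H →ₗ.[ℂ] H) (e k)
      (((c k : ℝ) : ℂ) • (u * e k)) := fun k => by
    refine DerivRestrictsTo.glue_restrictsTo hM hτ hd hE hfin hr (he k).1 (heE k) (her k) hg
      hgm ?_
    have h1 : b k * e k * E = b k * e k := by rw [mul_assoc, heE]
    have h2 : b k * e k ∈ M := mul_mem (hb k) (he k).1.1
    have h3 := (hbD k).mul_isProj hM hd (he k).1 (hmem _ (he k).1.1 (heE k)) (hmem _ h2 h1) hr.1
    have h4 := h3.smul hd ((c k : ℝ) : ℂ) (hmem _ (csmul_mem _ h2) (by rw [smul_mul_assoc, h1]))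
    rwa [hge, smul_mul_assoc]
  have hz := isMeasurableOperator_deriv d ⟨ofBounded g, hgm⟩
  have hbig : ∀ k : ℕ, (k : ℝ≥0∞) ≤ traceAbsPow τ (d ⟨ofBounded g, hgm⟩ : H →ₗ.[ℂ] H) 1 := by
    intro k
    have h1 := ofReal_mul_le_traceAbsPow hM hτ hz (he k).1
      (csmul_mem _ (mul_mem hu (he k).1.1)) (hres k) (hs k) (by
        rw [← hc]
        exact smul_le_star_mul_of_smul_le hM hF hu hle (he k).1 (he k).2.2 (c k))
    rw [(hτe k).2, ← ENNReal.ofReal_mul (by have := hs k; positivity)] at h1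
    have h2 : s k / 2 * (τ (e k)).toReal = k := by
      have := (hτe k).1.ne'
      simp only [s]
      field_simp
    rwa [h2, ENNReal.ofReal_natCast] at h1
  have hlt := (Set.mem_iInter₂.1 (d ⟨ofBounded g, hgm⟩).2 1 le_rfl).2
  obtain ⟨k, hk⟩ := ENNReal.exists_nat_gt hlt.ne
  exact absurd (hbig k) (not_le.2 hk)

theorem DerivRestrictsTo.of_nonneg (hM : IsAbelian M)
    (hτ : IsFaithfulNormalSemifiniteTrace M τ) (hd : IsArensDerivation M τ d) (hE : IsProj M E)
    (hfin : τ E < ∞) (ha : a ∈ M) (ha0 : 0 ≤ a) (haE : a * E = a) (r : H →L[ℂ] H) :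
    DerivRestrictsTo d a r 0 := by
  have hae := ofBounded_mem_arens hM hτ ha hE hfin haE
  refine ⟨hae, ?_⟩
  rw [deriv_nonneg_eq_zero hM hτ hd hE hfin ha ha0 haE hae]
  exact restrictsTo_zero r

/-- Adding `‖a‖ • E` makes `a` positive without changing its derivative. -/
theorem DerivRestrictsTo.of_isSelfAdjoint (hM : IsAbelian M)
    (hτ : IsFaithfulNormalSemifiniteTrace M τ) (hd : IsArensDerivation M τ d) (hE : IsProj M E)
    (hfin : τ E < ∞) (ha : a ∈ M) (hs : IsSelfAdjoint a) (haE : a * E = a) (r : H →L[ℂ] H) :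
    DerivRestrictsTo d a r 0 := by
  have h1 : ‖a‖ • E ∈ M := rsmul_mem _ hE.1
  have h2 : 0 ≤ a + ‖a‖ • E := by
    have h3 : -(‖a‖ • (1 : H →L[ℂ] H)) ∈ M := neg_mem (rsmul_mem _ (one_mem M))
    have := hM.mul_le_mul_right h3 ha (neg_norm_smul_one_le hs) hE.isPos
    rw [haE, neg_mul, smul_mul_assoc, one_mul] at this
    rwa [← neg_le_iff_add_nonneg]
  have h3 := DerivRestrictsTo.of_nonneg hM hτ hd hE hfin (add_mem ha h1) h2
    (by rw [add_mul, haE, smul_mul_assoc, hE.mul_self]) r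
  refine h3.congr_of_sub_mem_span hM hτ hd hE hfin ha haE ?_
  rw [add_sub_cancel_left, ← Complex.coe_smul]
  exact Submodule.smul_mem _ _ (Submodule.subset_span ⟨hE, hE.mul_self⟩)

theorem DerivRestrictsTo.of_mem (hM : IsAbelian M)
    (hτ : IsFaithfulNormalSemifiniteTrace M τ) (hd : IsArensDerivation M τ d) (hE : IsProj M E)
    (hfin : τ E < ∞) (ha : a ∈ M) (haE : a * E = a) (r : H →L[ℂ] H) :
    DerivRestrictsTo d a r 0 := by
  have hmem : ∀ a ∈ M, a * E = a → ofBounded a ∈ arens M τ := fun a ha haE =>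
    ofBounded_mem_arens hM hτ ha hE hfin haE
  have hsm := star_mem ha
  have hsE : star a * E = star a := by
    have := congrArg star haE
    rw [star_mul, hE.star_eq] at this
    rwa [hM _ hsm E hE.1]
  have h1 : a + star a ∈ M := add_mem ha hsm
  have h2 : Complex.I • (a - star a) ∈ M := csmul_mem _ (sub_mem ha hsm)
  have h1E : (a + star a) * E = a + star a := by rw [add_mul, haE, hsE]
  have h2E : (Complex.I • (a - star a)) * E = Complex.I • (a - star a) := by
    rw [smul_mul_assoc, sub_mul, haE, hsE]
  have h1s : IsSelfAdjoint (a + star a) := .add_star_self a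
  have h2s : IsSelfAdjoint (Complex.I • (a - star a)) := by
    rw [isSelfAdjoint_iff, star_smul, star_sub, star_star, Complex.star_def, Complex.conj_I,
      neg_smul, ← smul_neg, neg_sub]
  have h3 := (DerivRestrictsTo.of_isSelfAdjoint hM hτ hd hE hfin h1 h1s h1E r).smul hd (1 / 2)
    (hmem _ (csmul_mem _ h1) (by rw [smul_mul_assoc, h1E]))
  have h4 := (DerivRestrictsTo.of_isSelfAdjoint hM hτ hd hE hfin h2 h2s h2E r).smul hd
    (-(Complex.I / 2)) (hmem _ (csmul_mem _ h2) (by rw [smul_mul_assoc, h2E]))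
  have h5 : (1 / 2 : ℂ) • (a + star a) + (-(Complex.I / 2)) • Complex.I • (a - star a) = a := by
    rw [smul_smul, show -(Complex.I / 2) * Complex.I = 1 / 2 by
      linear_combination (-1 / 2 : ℂ) * Complex.I_mul_I, ← smul_add, add_add_sub_cancel,
      ← two_smul ℂ a, smul_smul]
    norm_num
  have h6 := h3.add hd h4 (by rw [h5]; exact hmem a ha haE)
  rwa [h5, smul_zero, smul_zero, add_zero] at h6

/-- Every derivation of the Arens algebra of an abelian von Neumann algebra is zero. -/
theorem arensDerivation_eq_zero (hM : IsAbelian M) (hτ : IsFaithfulNormalSemifiniteTrace M τ)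
    (hd : IsArensDerivation M τ d) (x : arens M τ) : (d x : H →ₗ.[ℂ] H) = 0 := by
  have hx := isMeasurableOperator_of_mem_arens x.2
  have hy := isMeasurableOperator_deriv d x
  obtain ⟨p, hp⟩ := hx.exists_isExhaustion
  obtain ⟨q, hq⟩ := hy.exists_isExhaustion
  obtain ⟨hp', hq'⟩ := hp.mul hM hq
  refine RestrictsTo.eq_zero_of_tendsto hy.isClosed hq'.tendsto fun n => ?_
  obtain ⟨a, ha, hra⟩ := hp'.bounded n
  obtain ⟨u, hu, hru⟩ := hq'.bounded n
  have hr := hp'.isProj n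
  generalize p n * q n = r at hra hru hr
  by_cases hu0 : u = 0
  · rwa [hu0] at hru
  exfalso
  obtain ⟨F, hF, hF0, hFr, ε, hε, hle⟩ := hru.exists_isProj_smul_le hM hr hu hu0
  -- Below `F` the trace may be infinite, so pass to a nonzero `E` of finite trace. There `x E` is
  -- bounded and has derivative zero, yet that derivative is `u * E ≠ 0`.
  obtain ⟨E, hE, hE0, hEF, hfin⟩ := hτ.exists_finite_isProj hM hF hF0
  have hEr : E * r = E := by rw [← hEF, mul_assoc, hFr]
  have haE : RestrictsTo (x : H →ₗ.[ℂ] H) E (a * E) := by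
    have := hra.mul_right E
    rwa [hM r hr.1 E hE.1, hEr] at this
  have h1 : a * E * E = a * E := by rw [mul_assoc, hE.mul_self]
  have h2 : a * E ∈ M := mul_mem ha hE.1
  have h3 := deriv_strongMul_isProj hM hd hE (ofBounded_mem_arens hM hτ hE.1 hE hfin hE.mul_self)
    haE (ofBounded_mem_arens hM hτ h2 hE hfin h1) hr.1 hru
  exact hE0 (eq_zero_of_smul_le hM hF hu hε hle hE hEF
    (h3.unique (DerivRestrictsTo.of_mem hM hτ hd hE hfin h2 h1 r)))

end VonNeumann

section FunctionAlgebra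

/-! ### Derivations of the Arens algebra of functions -/

variable {α : Type*} [MeasurableSpace α] {μ : Measure α}

/-- A bounded measurable function as an element of the Arens algebra of a finite measure. -/
def arensOfBounded (μ : Measure α) [IsFiniteMeasure μ] (f : α → ℂ) (hf : Measurable f) (C : ℝ)
    (hC : ∀ t, ‖f t‖ ≤ C) : arensFun μ :=
  ⟨AEEqFun.mk f hf.aestronglyMeasurable, fun _ _ =>
    (memLp_congr_ae (AEEqFun.coeFn_mk f hf.aestronglyMeasurable)).2
      (MemLp.of_bound hf.aestronglyMeasurable C (Eventually.of_forall hC))⟩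

theorem coe_mul_arensFun (f g : arensFun μ) : (f * g).1 = f.1 * g.1 := rfl

/-- The class of the indicator function of a measurable set. -/
def arensIndicator (μ : Measure α) [IsFiniteMeasure μ] {s : Set α} (hs : MeasurableSet s) :
    arensFun μ :=
  arensOfBounded μ (s.indicator 1) (measurable_one.indicator hs) 1 fun t => by
    refine (norm_indicator_le_norm_self _ _).trans ?_
    simp

theorem coeFn_arensOfBounded [IsFiniteMeasure μ] {f : α → ℂ} (hf : Measurable f) {C : ℝ}
    (hC : ∀ t, ‖f t‖ ≤ C) : ((arensOfBounded μ f hf C hC).1 : α → ℂ) =ᵐ[μ] f :=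
  AEEqFun.coeFn_mk _ _

theorem coeFn_arensIndicator [IsFiniteMeasure μ] {s : Set α} (hs : MeasurableSet s) :
    ((arensIndicator μ hs).1 : α → ℂ) =ᵐ[μ] s.indicator 1 :=
  coeFn_arensOfBounded _ _

theorem coeFn_mul_arensIndicator [IsFiniteMeasure μ] {s : Set α} (hs : MeasurableSet s)
    (f : arensFun μ) :
    ((f * arensIndicator μ hs).1 : α → ℂ) =ᵐ[μ] s.indicator (f.1 : α → ℂ) := by
  rw [coe_mul_arensFun]
  filter_upwards [AEEqFun.coeFn_mul f.1 (arensIndicator μ hs).1,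
    coeFn_arensIndicator (μ := μ) hs] with t h1 h2
  rw [h1, Pi.mul_apply, h2]
  by_cases ht : t ∈ s <;> simp [ht]

theorem arensFun_ext {f g : arensFun μ} (h : (f.1 : α → ℂ) =ᵐ[μ] g.1) : f = g :=
  Subtype.ext (AEEqFun.ext h)

theorem coeFn_zero_arensFun : ((0 : arensFun μ).1 : α → ℂ) =ᵐ[μ] 0 := AEEqFun.coeFn_zero

theorem arensFun_mul_zero (f : arensFun μ) : f * 0 = 0 := by
  refine arensFun_ext ?_
  rw [coe_mul_arensFun]
  filter_upwards [AEEqFun.coeFn_mul f.1 (0 : arensFun μ).1, coeFn_zero_arensFun (μ := μ)]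
    with t h1 h2
  rw [h1, Pi.mul_apply, h2, Pi.zero_apply, mul_zero]

theorem arensIndicator_mul_self [IsFiniteMeasure μ] {s : Set α} (hs : MeasurableSet s) :
    arensIndicator μ hs * arensIndicator μ hs = arensIndicator μ hs := by
  refine arensFun_ext ?_
  filter_upwards [coeFn_mul_arensIndicator hs (arensIndicator μ hs), coeFn_arensIndicator hs]
    with t h1 h2
  rw [h1]
  by_cases ht : t ∈ s
  · simp [ht]
  · simp [ht, h2]

section Derivation

variable [IsFiniteMeasure μ] {d : arensFun μ →ₗ[ℂ] arensFun μ}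

theorem funDeriv_indicator (hd : ∀ f g, d (f * g) = d f * g + f * d g) {s : Set α}
    (hs : MeasurableSet s) : d (arensIndicator μ hs) = 0 := by
  have h1 := hd (arensIndicator μ hs) (arensIndicator μ hs)
  have h2 : arensIndicator μ hs * d (arensIndicator μ hs) =
      d (arensIndicator μ hs) * arensIndicator μ hs := Subtype.ext (mul_comm _ _)
  rw [arensIndicator_mul_self hs, h2] at h1
  refine arensFun_ext ?_
  have h3 : ((d (arensIndicator μ hs) * arensIndicator μ hs +
    d (arensIndicator μ hs) * arensIndicator μ hs : arensFun μ).1 : α → ℂ) =ᵐ[μ] _ :=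
    AEEqFun.coeFn_add _ _
  rw [← h1] at h3
  filter_upwards [h3, coeFn_mul_arensIndicator hs (d (arensIndicator μ hs)),
    coeFn_zero_arensFun (μ := μ)] with t h4 h5 h6
  rw [Pi.add_apply, h5] at h4
  rw [h6]
  by_cases ht : t ∈ s <;> simpa [ht] using h4

theorem funDeriv_mul_indicator (hd : ∀ f g, d (f * g) = d f * g + f * d g) {s : Set α}
    (hs : MeasurableSet s) (f : arensFun μ) :
    d (f * arensIndicator μ hs) = d f * arensIndicator μ hs := by
  rw [hd, funDeriv_indicator hd hs, arensFun_mul_zero, add_zero]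

/-- Quantifying over all `f` almost everywhere equal to `φ` frees the induction from the choice of
representatives. -/
theorem funDeriv_simpleFunc (hd : ∀ f g, d (f * g) = d f * g + f * d g) (φ : SimpleFunc α ℂ) :
    ∀ f : arensFun μ, (f.1 : α → ℂ) =ᵐ[μ] φ → d f = 0 := by
  induction φ using SimpleFunc.induction with
  | const c hs =>
    rename_i s
    intro f hf
    have : f = c • arensIndicator μ hs := by
      refine arensFun_ext ?_
      have h1 : ((c • arensIndicator μ hs : arensFun μ).1 : α → ℂ) =ᵐ[μ]
        c • ((arensIndicator μ hs).1 : α → ℂ) := AEEqFun.coeFn_smul c _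
      filter_upwards [hf, h1, coeFn_arensIndicator hs] with t h3 h4 h5
      rw [h3, h4, Pi.smul_apply, h5]
      by_cases ht : t ∈ s <;> simp [ht]
    rw [this, map_smul, funDeriv_indicator hd hs, smul_zero]
  | add _ hφ hψ =>
    rename_i φ ψ _
    intro f hf
    obtain ⟨C, hC⟩ := φ.exists_forall_norm_le
    obtain ⟨C', hC'⟩ := ψ.exists_forall_norm_le
    have h1 := coeFn_arensOfBounded (μ := μ) φ.measurable hC
    have h2 := coeFn_arensOfBounded (μ := μ) ψ.measurable hC'
    have : f = arensOfBounded μ φ φ.measurable C hC + arensOfBounded μ ψ ψ.measurable C' hC' := by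
      refine arensFun_ext ?_
      have h3 : ((arensOfBounded μ φ φ.measurable C hC +
        arensOfBounded μ ψ ψ.measurable C' hC' : arensFun μ).1 : α → ℂ) =ᵐ[μ] _ :=
        AEEqFun.coeFn_add _ _
      filter_upwards [hf, h1, h2, h3] with t h4 h5 h6 h7
      rw [h4, h7, Pi.add_apply, h5, h6]
      rfl
    rw [this, map_add, hφ _ h1, hψ _ h2, add_zero]

end Derivation

/-! ### Uniform approximation, disjoint sets and gluing of functions -/

theorem exists_simpleFunc_norm_sub_le {f : α → ℂ} (hf : Measurable f) {C : ℝ}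
    (hC : ∀ t, ‖f t‖ ≤ C) {ε : ℝ} (hε : 0 < ε) :
    ∃ φ : SimpleFunc α ℂ, ∀ t, ‖f t - φ t‖ ≤ ε := by
  let e : ℕ → ℂ := TopologicalSpace.denseSeq ℂ
  -- Compactness of the ball makes finitely many points of the dense sequence an `ε`-net, so
  -- rounding to the nearest one is uniformly accurate.
  have hcov : Metric.closedBall (0 : ℂ) C ⊆ ⋃ k, Metric.ball (e k) ε := fun z _ => by
    obtain ⟨k, hk⟩ := Metric.denseRange_iff.1 (TopologicalSpace.denseRange_denseSeq ℂ) z ε hε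
    exact Set.mem_iUnion.2 ⟨k, hk⟩
  obtain ⟨s, hs⟩ := (isCompact_closedBall (0 : ℂ) C).elim_finite_subcover _
    (fun _ => Metric.isOpen_ball) hcov
  refine ⟨(SimpleFunc.nearestPt e (s.sup id)).comp f hf, fun t => ?_⟩
  obtain ⟨k, hk, hk'⟩ := Set.mem_iUnion₂.1 (hs (mem_closedBall_zero_iff.2 (hC t)))
  have h1 := SimpleFunc.edist_nearestPt_le e (f t) (Finset.le_sup (f := id) hk)
  rw [edist_dist, edist_dist, ENNReal.ofReal_le_ofReal_iff dist_nonneg] at h1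
  rw [← dist_eq_norm, dist_comm]
  refine h1.trans ?_
  rw [dist_comm]
  exact (Metric.mem_ball.1 hk').le

/-- Near a suitable point `x` the set `F` has positive measure in every ball, while these measures
tend to `ν {x} = 0`. Along a subsequence they decrease strictly, and the successive shells are
disjoint of positive measure. -/
theorem exists_disjoint_pos_measure {ν : Measure ℝ} [IsFiniteMeasure ν] [NullSingletonClass ν] {F : Set ℝ}
    (hF : MeasurableSet F) (hF0 : ν F ≠ 0) :
    ∃ e : ℕ → Set ℝ, (∀ k, MeasurableSet (e k) ∧ e k ⊆ F ∧ ν (e k) ≠ 0) ∧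
      ∀ j k, j ≠ k → Disjoint (e j) (e k) := by
  obtain ⟨x, -, hx⟩ := exists_mem_forall_mem_nhdsWithin_pos_measure hF0
  let G : ℕ → Set ℝ := fun n => F ∩ Metric.ball x (1 / (n + 1))
  have hGm : ∀ n, MeasurableSet (G n) := fun n => hF.inter Metric.isOpen_ball.measurableSet
  have hGpos : ∀ n, 0 < ν (G n) := fun n =>
    hx _ (inter_mem_nhdsWithin F (Metric.ball_mem_nhds x Nat.one_div_pos_of_nat))
  have hGanti : Antitone G := fun m n hmn => by
    refine Set.inter_subset_inter_right F (Metric.ball_subset_ball ?_)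
    exact Nat.one_div_le_one_div hmn
  have hGzero : Tendsto (ν ∘ G) atTop (𝓝 0) := by
    have h1 := tendsto_measure_iInter_atTop (μ := ν) (fun n => (hGm n).nullMeasurableSet) hGanti
      ⟨0, measure_ne_top _ _⟩
    have h2 : ⋂ n, G n ⊆ {x} := fun y hy => by
      rw [Set.mem_singleton_iff]
      by_contra hne
      obtain ⟨n, hn⟩ := exists_nat_one_div_lt (dist_pos.2 hne)
      exact lt_asymm hn (Metric.mem_ball.1 (Set.mem_iInter.1 hy n).2)
    rwa [measure_mono_null h2 (measure_singleton x)] at h1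
  have hstep : ∀ n, ∃ m, n < m ∧ ν (G m) < ν (G n) := fun n =>
    ((eventually_gt_atTop n).and (hGzero.eventually_lt_const (hGpos n))).exists
  choose next hn1 hn2 using hstep
  let N : ℕ → ℕ := fun k => Nat.rec 0 (fun _ => next) k
  have hN : StrictMono N := strictMono_nat_of_lt_succ fun k => hn1 (N k)
  have hlt : ∀ k, ν (G (N (k + 1))) < ν (G (N k)) := fun k => hn2 (N k)
  have hdisj : ∀ j k, j < k → Disjoint (G (N j) \ G (N (j + 1))) (G (N k) \ G (N (k + 1))) :=
    fun j k hjk => Set.disjoint_left.2 fun t ht ht' => ht.2 (hGanti (hN.monotone hjk) ht'.1)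
  refine ⟨fun k => G (N k) \ G (N (k + 1)), fun k => ⟨(hGm _).diff (hGm _),
    fun t ht => ht.1.1, fun h0 => (hlt k).not_ge ?_⟩, fun j k hjk => ?_⟩
  · exact measure_mono_ae (ae_le_set.2 h0)
  · rcases lt_or_gt_of_ne hjk with h | h
    · exact hdisj j k h
    · exact (hdisj k j h).symm

/-- Disjointness makes a uniform bound on the pieces enough; no summability is required. -/
theorem exists_glue_fun {e : ℕ → Set α} (he : ∀ k, MeasurableSet (e k))
    (hdisj : ∀ j k, j ≠ k → Disjoint (e j) (e k)) {b : ℕ → α → ℂ} (hb : ∀ k, Measurable (b k))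
    (hb1 : ∀ k t, ‖b k t‖ ≤ 1) :
    ∃ g : α → ℂ, Measurable g ∧ (∀ t, ‖g t‖ ≤ 1) ∧ ∀ k, ∀ t ∈ e k, g t = b k t := by
  obtain ⟨f, hf, hfe⟩ := exists_measurable_piecewise e he b hb fun j k hjk t ht =>
    absurd ht.2 (Set.disjoint_left.1 (hdisj j k hjk) ht.1)
  refine ⟨(⋃ k, e k).indicator f, hf.indicator (.iUnion he), fun t => ?_, fun k t ht => ?_⟩
  · by_cases ht : t ∈ ⋃ k, e k
    · rw [Set.indicator_of_mem ht]
      obtain ⟨k, hk⟩ := Set.mem_iUnion.1 ht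
      rw [hfe k hk]
      exact hb1 k t
    · rw [Set.indicator_of_notMem ht, norm_zero]
      exact zero_le_one
  · rw [Set.indicator_of_mem (Set.mem_iUnion.2 ⟨k, ht⟩), hfe k ht]

/-! ### Vanishing for finite measures without atoms -/

section Derivation

variable {ν : Measure ℝ} [IsFiniteMeasure ν] [NullSingletonClass ν] {d : arensFun ν →ₗ[ℂ] arensFun ν}

/-- The gluing contradiction with integrals: the glued `g` is bounded by `1`, yet the integral of
`|d g|` over `e k` is `k` for every `k`. -/
theorem funDeriv_arensOfBounded (hd : ∀ f g, d (f * g) = d f * g + f * d g) {f : ℝ → ℂ}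
    (hf : Measurable f) {C : ℝ} (hC : ∀ t, ‖f t‖ ≤ C) : d (arensOfBounded ν f hf C hC) = 0 := by
  by_contra hne
  set w := d (arensOfBounded ν f hf C hC) with hw
  have hwm : Measurable (w.1 : ℝ → ℂ) := w.1.stronglyMeasurable.measurable
  have hwint : ∫⁻ t, ‖w.1 t‖ₑ ∂ν < ∞ := by
    have := w.2 1 le_rfl
    rw [ENNReal.ofReal_one] at this
    exact (memLp_one_iff_integrable.1 this).2
  have hFm : MeasurableSet {t | w.1 t ≠ 0} := (measurableSet_singleton 0).compl.preimage hwm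
  have hF0 : ν {t | w.1 t ≠ 0} ≠ 0 := fun h0 => by
    refine hne (arensFun_ext ?_)
    exact EventuallyEq.trans (g := 0) (ae_iff.2 h0) coeFn_zero_arensFun.symm
  obtain ⟨e, he, hdisj⟩ := exists_disjoint_pos_measure hFm hF0
  let I : ℕ → ℝ := fun k => (∫⁻ t in e k, ‖w.1 t‖ₑ ∂ν).toReal
  have hI : ∀ k, 0 < I k ∧ ∫⁻ t in e k, ‖w.1 t‖ₑ ∂ν = ENNReal.ofReal (I k) := fun k => by
    have h1 : ∫⁻ t in e k, ‖w.1 t‖ₑ ∂ν ≠ ∞ := ((setLIntegral_le_lintegral _ _).trans_lt hwint).ne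
    have h2 : ∫⁻ t in e k, ‖w.1 t‖ₑ ∂ν ≠ 0 := fun h0 => by
      refine (he k).2.2 ?_
      rw [setLIntegral_eq_zero_iff (he k).1 hwm.enorm] at h0
      have h3 : ∀ᵐ t ∂ν, t ∉ e k := by
        filter_upwards [h0] with t ht hte
        exact (he k).2.1 hte (enorm_eq_zero.1 (ht hte))
      simpa [ae_iff] using h3
    exact ⟨ENNReal.toReal_pos h2 h1, (ENNReal.ofReal_toReal h1).symm⟩
  -- The integral of `|w|` over `e k` is positive, so it can be normalised directly and no lower
  -- bound for `|w|` is needed.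
  let c : ℕ → ℝ := fun k => k / I k
  have hc : ∀ k, 0 ≤ c k := fun k => by have := (hI k).1; positivity
  -- `φ` approximates `-f`, so `f + φ` is small and has the same derivative `w`.
  have happ : ∀ k, ∃ φ : SimpleFunc ℝ ℂ, ∀ t, ‖f t + φ t‖ ≤ 1 / (c k + 1) := fun k => by
    obtain ⟨φ, hφ⟩ := exists_simpleFunc_norm_sub_le hf.neg (C := C) (by simpa using hC)
      (show 0 < 1 / (c k + 1) by have := hc k; positivity)
    refine ⟨φ, fun t => ?_⟩
    rw [← norm_neg, neg_add']
    exact hφ t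
  choose φ hφ using happ
  obtain ⟨g, hg, hg1, hge⟩ := exists_glue_fun (fun k => (he k).1) hdisj
    (b := fun k t => (c k : ℂ) * (f t + φ k t))
    (fun k => (hf.add (φ k).measurable).const_mul _) fun k t => by
      have h1 := hc k
      rw [norm_mul, Complex.norm_real, Real.norm_of_nonneg h1]
      calc c k * ‖f t + φ k t‖ ≤ (c k + 1) * (1 / (c k + 1)) := by
            gcongr
            · linarith
            · exact hφ k t
        _ = 1 := by field_simp
  let z := d (arensOfBounded ν g hg 1 hg1)
  have hz : ∀ k, ∀ᵐ t ∂ν, t ∈ e k → z.1 t = c k * w.1 t := fun k => by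
    obtain ⟨D, hD⟩ := (φ k).exists_forall_norm_le
    have h1 : arensOfBounded ν g hg 1 hg1 * arensIndicator ν (he k).1 =
        ((c k : ℝ) : ℂ) • ((arensOfBounded ν f hf C hC +
          arensOfBounded ν (φ k) (φ k).measurable D hD) * arensIndicator ν (he k).1) := by
      refine arensFun_ext ?_
      refine (coeFn_mul_arensIndicator _ _).trans (EventuallyEq.symm ?_)
      refine EventuallyEq.trans (AEEqFun.coeFn_smul _ _) ?_
      have h2 : (((arensOfBounded ν f hf C hC +
        arensOfBounded ν (φ k) (φ k).measurable D hD : arensFun ν)).1 : ℝ → ℂ) =ᵐ[ν] _ :=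
        AEEqFun.coeFn_add _ _
      filter_upwards [coeFn_mul_arensIndicator (he k).1 (arensOfBounded ν f hf C hC +
          arensOfBounded ν (φ k) (φ k).measurable D hD), h2, coeFn_arensOfBounded (μ := ν) hf hC,
        coeFn_arensOfBounded (μ := ν) (φ k).measurable hD,
        coeFn_arensOfBounded (μ := ν) hg hg1] with t h3 h4 h5 h6 h7
      rw [Pi.smul_apply, h3]
      by_cases ht : t ∈ e k
      · rw [Set.indicator_of_mem ht, Set.indicator_of_mem ht, h4, h7, Pi.add_apply, h5, h6,
          hge k t ht, smul_eq_mul]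
      · rw [Set.indicator_of_notMem ht, Set.indicator_of_notMem ht, smul_zero]
    have h2 := congrArg d h1
    have h0 : d (arensOfBounded ν f hf C hC +
        arensOfBounded ν (φ k) (φ k).measurable D hD) = w := by
      rw [map_add, funDeriv_simpleFunc hd (φ k) _ (coeFn_arensOfBounded (φ k).measurable hD), add_zero]
    rw [funDeriv_mul_indicator hd, map_smul, funDeriv_mul_indicator hd, h0] at h2
    have h3 : ((((c k : ℝ) : ℂ) • (w * arensIndicator ν (he k).1) : arensFun ν).1 : ℝ → ℂ)
      =ᵐ[ν] ((c k : ℝ) : ℂ) • ((w * arensIndicator ν (he k).1).1 : ℝ → ℂ) := AEEqFun.coeFn_smul _ _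
    filter_upwards [coeFn_mul_arensIndicator (he k).1 z, h3,
      coeFn_mul_arensIndicator (he k).1 w] with t h4 h5 h6 ht
    rw [h2, h5, Pi.smul_apply, h6, Set.indicator_of_mem ht, Set.indicator_of_mem ht] at h4
    exact h4.symm
  have hzint : ∫⁻ t, ‖z.1 t‖ₑ ∂ν < ∞ := by
    have := z.2 1 le_rfl
    rw [ENNReal.ofReal_one] at this
    exact (memLp_one_iff_integrable.1 this).2
  obtain ⟨k, hk⟩ := ENNReal.exists_nat_gt hzint.ne
  refine hk.not_ge ?_
  calc (k : ℝ≥0∞) = ENNReal.ofReal (c k) * ENNReal.ofReal (I k) := by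
        rw [← ENNReal.ofReal_mul (hc k), div_mul_cancel₀ _ (hI k).1.ne', ENNReal.ofReal_natCast]
    _ = ∫⁻ t in e k, ENNReal.ofReal (c k) * ‖w.1 t‖ₑ ∂ν := by
        rw [← (hI k).2, lintegral_const_mul _ hwm.enorm]
    _ = ∫⁻ t in e k, ‖z.1 t‖ₑ ∂ν := by
        refine setLIntegral_congr_fun_ae (he k).1 ?_
        filter_upwards [hz k] with t ht hte
        rw [ht hte, enorm_mul, ← ofReal_norm (c k : ℂ), Complex.norm_real,
          Real.norm_of_nonneg (hc k)]
    _ ≤ ∫⁻ t, ‖z.1 t‖ₑ ∂ν := setLIntegral_le_lintegral _ _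

/-- Every derivation of the Arens algebra of a finite atomless measure on `ℝ` is zero. -/
theorem funDeriv_eq_zero (hd : ∀ f g, d (f * g) = d f * g + f * d g) : d = 0 := by
  refine LinearMap.ext fun f => arensFun_ext ?_
  have hfm : Measurable (f.1 : ℝ → ℂ) := f.1.stronglyMeasurable.measurable
  have hS : ∀ N : ℕ, MeasurableSet {t | ‖f.1 t‖ ≤ N} := fun N =>
    measurableSet_le hfm.norm measurable_const
  have hzero : ∀ N : ℕ, ∀ᵐ t ∂ν, ‖f.1 t‖ ≤ N → (d f).1 t = 0 := fun N => by
    -- Truncating `f` to `{‖f‖ ≤ N}` gives a bounded function, so `d f` vanishes on that set; these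
    -- sets cover the line.
    have hb : ∀ t, ‖({t | ‖f.1 t‖ ≤ N}.indicator f.1 : ℝ → ℂ) t‖ ≤ N := fun t => by
      by_cases ht : t ∈ {t | ‖f.1 t‖ ≤ N}
      · rw [Set.indicator_of_mem ht]
        exact ht
      · rw [Set.indicator_of_notMem ht, norm_zero]
        exact N.cast_nonneg
    have h1 : f * arensIndicator ν (hS N) =
        arensOfBounded ν ({t | ‖f.1 t‖ ≤ N}.indicator f.1) (hfm.indicator (hS N)) N hb :=
      arensFun_ext ((coeFn_mul_arensIndicator _ _).trans (coeFn_arensOfBounded _ _).symm)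
    have h2 := congrArg d h1
    rw [funDeriv_mul_indicator hd, funDeriv_arensOfBounded hd] at h2
    have h3 := coeFn_mul_arensIndicator (hS N) (d f)
    rw [h2] at h3
    filter_upwards [h3, coeFn_zero_arensFun (μ := ν)] with t h4 h5 ht
    rw [Set.indicator_of_mem (show t ∈ {t | ‖f.1 t‖ ≤ N} from ht)] at h4
    rw [← h4]
    exact h5
  filter_upwards [ae_all_iff.2 hzero, coeFn_zero_arensFun (μ := ν)] with t h1 h2
  obtain ⟨N, hN⟩ := exists_nat_ge ‖f.1 t‖
  rw [h1 N hN]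
  exact h2.symm

end Derivation

end FunctionAlgebra

end ArensAlgebra

end

theorem corollary3p5 :
    (∀ (H : Type*) [NormedAddCommGroup H] [InnerProductSpace ℂ H] [CompleteSpace H]
      (M : VonNeumannAlgebra H) (τ : (H →L[ℂ] H) → ℝ≥0∞),
      (∀ a ∈ M, ∀ b ∈ M, a * b = b * a) →
      ArensAlgebra.IsFaithfulNormalSemifiniteTrace M τ →
      ∀ d : ArensAlgebra.arens M τ → ArensAlgebra.arens M τ,
        ArensAlgebra.IsArensDerivation M τ d →
        ∀ x, (d x : H →ₗ.[ℂ] H) = 0) ∧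
    (∀ d : ArensAlgebra.arensUnitInterval →ₗ[ℂ] ArensAlgebra.arensUnitInterval,
      (∀ f g, d (f * g) = d f * g + f * d g) → d = 0) :=
  ⟨fun _ _ _ _ _ _ hM hτ _ hd x => ArensAlgebra.arensDerivation_eq_zero hM hτ hd x,
    fun _ hd => ArensAlgebra.funDeriv_eq_zero hd⟩
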